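/- **Theorem (Formal WKB Expansion).** Let $n\ge 0$ and let $(q,p)$ be the standard coordinates of $T^*\mathbb R^n$, with projection $\pi(q,p)=q$ and zero section $i(q)=(q,0)$. For a vector space $V$ let $V((\lambda))$ denote the formal Laurent series with finite principal part. Put $$M_b(f,g)=\Big(\sum_k \partial_{q^k}\partial_{p'_k}-\partial_{p_k}\partial_{q'^k}\Big)^b\big(f(q,p)g(q',p')\big)\Big|_{q=q',\,p=p'},\qquad f*g=\sum_{b\ge0}\frac{1}{b!}\Big(\frac{i\lambda}{2}\Big)^bM_b(f,g)$$ (the Weyl product), $\{f,g\}=M_1(f,g)$, $\Delta=\sum_k\frac{\partial^2}{\partial q^k\partial p_k}$, $\mathcal S=\exp(-\frac{i\lambda}{2}\Delta)$ and $$\pi_0(f)\phi=i^*\mathcal S(f*\pi^*\phi),\qquad f\in C^\infty(T^*\mathbb R^n)((\lambda)),\ \phi\in C_0^\infty(\mathbb R^n)'((\lambda)).$$ Here, for a distribution $u$ on $\mathbb R^n$, expressions $\sum_jF_j\,\pi^*u_j$ with $F_j\in C^\infty(T^*\mathbb R^n)$ are differentiated by the rules $\partial_{p_k}(F\pi^*u)=(\partial_{p_k}F)\pi^*u$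 and $\partial_{q^k}(F\pi^*u)=(\partial_{q^k}F)\pi^*u+F\pi^*(\partial_ku)$, and $i^*(F\pi^*u)=(i^*F)u$. Let $H\in C^\infty(T^*\mathbb R^n)$ and $S\in C^\infty(\mathbb R^n)$ be real-valued and let $E\in\mathbb R$ be such that $H(q,dS(q))=E$ for all $q\in\mathbb R^n$. Let $\Phi_t(q,p)=(q,p-t\,dS(q))$ be the Hamiltonian flow of $\pi^*S$. Then: 1. There is exactly one family of maps $A_t$ ($t\in\mathbb R$) of $C^\infty(T^*\mathbb R^n)((\lambda))$ into itself such that, for every $f_0$, the curve $f(t)=A_tf_0$ is a smooth curve (its coefficients are smooth in $(t,q,p)$ and its principal part is bounded locally uniformly in $t$) which solves the Heisenberg equation $$\frac{df}{dt}=\frac i\lambda\big((\pi^*S)*f-f*(\pi^*S)\big),\qquad f(0)=f_0 .$$ 2. There is exactly one factorization $A_t=\Phi_t^*\circ T_t$ with $T_t=\sum_{r\ge0}\lambda^rT_t^{(r)}$, where $T_t^{(0)}=1$ and the $T_t^{(r)}$ are differential operators on $T^*\mathbb R^n$ (of finite order, with smooth coefficients). 3. For all distributions $\phi_r\in C_0^\infty(\mathbb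 R^n)'$, $r\ge0$, the formal series $\phi=\sum_{r\ge0}\lambda^r\phi_r$ satisfies the time-independent Schrödinger equation $$\pi_0(A_{-1}H)\phi=E\phi$$ if and only if for every integer $r\ge0$ $$\big(i^*\Phi_{-1}^*T_{-1}^{(1)}H\big)\phi_r-\frac i2\,i^*\Delta\big((\Phi_{-1}^*H)(\pi^*\phi_r)\big)+\frac i2\,i^*\{\Phi_{-1}^*H,\pi^*\phi_r\}$$ $$=-\sum_{\substack{a+b+c+d=r+1\\ a,b,c,d\ge0,\ d<r}}\frac{(-i/2)^a}{a!}\frac{(i/2)^b}{b!}\,i^*\Delta^a\Big(M_b\big(\Phi_{-1}^*T_{-1}^{(c)}H,\ \pi^*\phi_d\big)\Big).$$ -/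

import Mathlib

open scoped ContDiff Topology TensorProduct Distributions

noncomputable section

namespace FormalWKB

/-! ### Smooth functions -/

/-- The configuration space `ℝⁿ`. -/
abbrev Q (n : ℕ) : Type := EuclideanSpace ℝ (Fin n)

/-- The phase space `T*ℝⁿ = {(q, p)}`, in the standard coordinates. -/
abbrev P (n : ℕ) : Type := Q n × Q n

section General

variable (E : Type*) [NormedAddCommGroup E] [NormedSpace ℝ E]

/-- The smooth complex-valued functions, as a subalgebra of all functions. -/
def smoothSubalgebra : Subalgebra ℂ (E → ℂ) where
  carrier := {f | ContDiff ℝ ∞ f}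
  mul_mem' {f g} (hf : ContDiff ℝ ∞ f) (hg : ContDiff ℝ ∞ g) := hf.mul hg
  add_mem' {f g} (hf : ContDiff ℝ ∞ f) (hg : ContDiff ℝ ∞ g) := hf.add hg
  algebraMap_mem' c := (contDiff_const : ContDiff ℝ ∞ fun _ : E => c)

/-- `C^∞(E)`, the algebra of smooth complex-valued functions. -/
def Smooth : Type _ := smoothSubalgebra E

instance : CommRing (Smooth E) := inferInstanceAs (CommRing (smoothSubalgebra E))

instance : Algebra ℂ (Smooth E) := inferInstanceAs (Algebra ℂ (smoothSubalgebra E))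

instance : FunLike (Smooth E) E ℂ where
  coe f := f.1
  coe_injective := Subtype.val_injective

/-- Smooth real-valued functions. -/
abbrev RealSmooth : Type _ := {f : E → ℝ // ContDiff ℝ ∞ f}

variable {E}

namespace Smooth

theorem contDiff (f : Smooth E) : ContDiff ℝ ∞ f := f.2

theorem differentiable (f : Smooth E) : Differentiable ℝ f := f.contDiff.differentiable (by simp)

/-- The element of `C^∞(E)` given by a smooth function. -/
def mk (f : E → ℂ) (hf : ContDiff ℝ ∞ f) : Smooth E := ⟨f, hf⟩

@[ext]
theorem ext {f g : Smooth E} (h : ∀ x, f x = g x) : f = g := DFunLike.ext f g h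

@[simp] theorem mk_apply (f : E → ℂ) (hf : ContDiff ℝ ∞ f) (x : E) : mk f hf x = f x := rfl
@[simp] theorem zero_apply (x : E) : (0 : Smooth E) x = 0 := rfl
@[simp] theorem one_apply (x : E) : (1 : Smooth E) x = 1 := rfl
@[simp] theorem add_apply (f g : Smooth E) (x : E) : (f + g) x = f x + g x := rfl
@[simp] theorem mul_apply (f g : Smooth E) (x : E) : (f * g) x = f x * g x := rfl
@[simp] theorem neg_apply (f : Smooth E) (x : E) : (-f) x = -f x := rfl
@[simp] theorem sub_apply (f g : Smooth E) (x : E) : (f - g) x = f x - g x := rfl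
@[simp] theorem smul_apply (c : ℂ) (f : Smooth E) (x : E) : (c • f) x = c * f x := rfl

end Smooth

/-- A real-valued smooth function, viewed as a complex-valued one. -/
def complexify (f : RealSmooth E) : Smooth E :=
  .mk (fun x => (f.1 x : ℂ)) (Complex.ofRealCLM.contDiff.comp f.2)

/-- The derivative of a smooth function in the direction of the constant vector field `v`. -/
def dirDeriv (v : E) : Smooth E →ₗ[ℂ] Smooth E where
  toFun f := .mk (fun x => fderiv ℝ f x v)
    ((f.contDiff.fderiv_right (m := ∞) (by simp)).clm_apply contDiff_const)
  map_add' f g := by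
    ext x
    change fderiv ℝ ((f : E → ℂ) + (g : E → ℂ)) x v = fderiv ℝ f x v + fderiv ℝ g x v
    rw [fderiv_add (f.differentiable x) (g.differentiable x)]; rfl
  map_smul' c f := by
    ext x
    change fderiv ℝ (c • (f : E → ℂ)) x v = c • fderiv ℝ f x v
    rw [fderiv_const_smul (f.differentiable x)]; rfl

theorem dirDeriv_apply (v : E) (f : Smooth E) (x : E) : dirDeriv v f x = fderiv ℝ f x v := rfl

theorem dirDeriv_mul (v : E) (f g : Smooth E) :
    dirDeriv v (f * g) = dirDeriv v f * g + f * dirDeriv v g := by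
  ext x
  change fderiv ℝ ((f : E → ℂ) * (g : E → ℂ)) x v = fderiv ℝ f x v * g x + f x * fderiv ℝ g x v
  rw [fderiv_mul (f.differentiable x) (g.differentiable x)]
  simp
  ring

/-- The pull-back `h^* : C^∞(F) → C^∞(E)` along a smooth map `h : E → F`. -/
def pullback {F : Type*} [NormedAddCommGroup F] [NormedSpace ℝ F] (h : E → F)
    (hh : ContDiff ℝ ∞ h) : Smooth F →ₐ[ℂ] Smooth E where
  toFun f := .mk (fun x => f (h x)) (f.contDiff.comp hh)
  map_one' := rfl
  map_mul' _ _ := rfl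
  map_zero' := rfl
  map_add' _ _ := rfl
  commutes' _ := rfl

end General

variable {n : ℕ}

/-- The coordinate vector `∂/∂q^k` of `ℝⁿ`. -/
def basisVec (k : Fin n) : Q n := EuclideanSpace.single k 1

/-- `∂/∂q^k` on `C^∞(T*ℝⁿ)`. -/
def dq (k : Fin n) : Smooth (P n) →ₗ[ℂ] Smooth (P n) := dirDeriv (basisVec k, 0)

/-- `∂/∂p_k` on `C^∞(T*ℝⁿ)`. -/
def dp (k : Fin n) : Smooth (P n) →ₗ[ℂ] Smooth (P n) := dirDeriv (0, basisVec k)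

/-- `π^* : C^∞(ℝⁿ) → C^∞(T*ℝⁿ)` for the bundle projection `π(q, p) = q`. -/
def piStar : Smooth (Q n) →ₐ[ℂ] Smooth (P n) := pullback Prod.fst contDiff_fst

/-- `i^* : C^∞(T*ℝⁿ) → C^∞(ℝⁿ)` for the zero section `i(q) = (q, 0)`. -/
def iStar : Smooth (P n) →ₐ[ℂ] Smooth (Q n) :=
  pullback (fun q => (q, 0)) (contDiff_id.prodMk contDiff_const)

/-- Differential operators on `T*ℝⁿ` (of finite order, with smooth coefficients): the algebra
generated by the multiplications by smooth functions and by the coordinate derivatives. -/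
def diffOps (n : ℕ) : Subalgebra ℂ (Module.End ℂ (Smooth (P n))) :=
  Algebra.adjoin ℂ (Set.range (LinearMap.mulLeft ℂ) ∪ Set.range dq ∪ Set.range dp)

/-! ### The differential of `S` and the Hamiltonian flow of `π^*S` -/

/-- The differential `dS(q)`, as the covector with coordinates `p_k = ∂S/∂q^k (q)`. -/
def dCov (S : RealSmooth (Q n)) (q : Q n) : Q n :=
  WithLp.toLp 2 fun k => fderiv ℝ S.1 q (basisVec k)

theorem contDiff_dCov (S : RealSmooth (Q n)) : ContDiff ℝ ∞ (dCov S) := by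
  rw [contDiff_euclidean]
  intro k
  exact (ContDiff.fderiv_right (m := ∞) S.2 (by simp)).clm_apply contDiff_const

/-- The Hamiltonian flow `Φ_t` of `π^*S`: the translation `(q, p) ↦ (q, p - t dS(q))`. -/
def flow (S : RealSmooth (Q n)) (t : ℝ) (x : P n) : P n := (x.1, x.2 - t • dCov S x.1)

theorem contDiff_flow (S : RealSmooth (Q n)) (t : ℝ) : ContDiff ℝ ∞ (flow S t) :=
  contDiff_fst.prodMk (contDiff_snd.sub (((contDiff_dCov S).comp contDiff_fst).const_smul t))

/-- The Hamiltonian vector field `X_F = ∑_k (∂F/∂p_k ∂/∂q^k - ∂F/∂q^k ∂/∂p_k)`. -/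
def hamiltonianVF (F : P n → ℝ) (x : P n) : P n :=
  (WithLp.toLp 2 fun k => fderiv ℝ F x (0, basisVec k),
    WithLp.toLp 2 fun k => - fderiv ℝ F x (basisVec k, 0))

theorem flow_zero (S : RealSmooth (Q n)) (x : P n) : flow S 0 x = x := by
  simp [flow]

/-- `flow S` is indeed the Hamiltonian flow of `π^*S`. -/
theorem hasDerivAt_flow (S : RealSmooth (Q n)) (t : ℝ) (x : P n) :
    HasDerivAt (fun s => flow S s x)
      (hamiltonianVF (fun y : P n => S.1 y.1) (flow S t x)) t := by
  have hS : Differentiable ℝ S.1 := S.2.differentiable (by simp)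
  have h1 : ∀ v : P n, fderiv ℝ (fun y : P n => S.1 y.1) (flow S t x) v
      = fderiv ℝ S.1 x.1 v.1 := by
    intro v
    have := (hS x.1).hasFDerivAt.comp (flow S t x)
      (hasFDerivAt_fst (𝕜 := ℝ) (E := Q n) (F := Q n) (p := flow S t x))
    have h2 : HasFDerivAt (fun y : P n => S.1 y.1)
      ((fderiv ℝ S.1 x.1).comp (ContinuousLinearMap.fst ℝ (Q n) (Q n))) (flow S t x) := this
    rw [h2.fderiv]; rfl
  have h3 : hamiltonianVF (fun y : P n => S.1 y.1) (flow S t x) = (0, 0 - (1 : ℝ) • dCov S x.1) := by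
    unfold hamiltonianVF
    simp only [h1]
    ext k <;> simp [dCov]
  rw [h3]
  exact (hasDerivAt_const t x.1).prodMk
    ((hasDerivAt_const t x.2).sub ((hasDerivAt_id t).smul_const (dCov S x.1)))

/-- `Φ_t^* : C^∞(T*ℝⁿ) → C^∞(T*ℝⁿ)`. -/
def flowStar (S : RealSmooth (Q n)) (t : ℝ) : Smooth (P n) →ₐ[ℂ] Smooth (P n) :=
  pullback (flow S t) (contDiff_flow S t)

/-! ### Distributions on `ℝⁿ` -/

/-- `C_0^∞(ℝⁿ)`, with its canonical LF topology. -/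
abbrev Test (n : ℕ) : Type := 𝓓((⊤ : TopologicalSpace.Opens (Q n)), ℂ)

/-- `C_0^∞(ℝⁿ)'`, the space of distributions on `ℝⁿ`. -/
def Distr (n : ℕ) : Type := Test n →L[ℂ] ℂ

instance : AddCommGroup (Distr n) := inferInstanceAs (AddCommGroup (Test n →L[ℂ] ℂ))

instance : Module ℂ (Distr n) := inferInstanceAs (Module ℂ (Test n →L[ℂ] ℂ))

instance : FunLike (Distr n) (Test n) ℂ := inferInstanceAs (FunLike (Test n →L[ℂ] ℂ) (Test n) ℂ)

instance : ContinuousLinearMapClass (Distr n) ℂ (Test n) ℂ :=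
  inferInstanceAs (ContinuousLinearMapClass (Test n →L[ℂ] ℂ) ℂ (Test n) ℂ)

/-- Multiplication of a test function by a smooth function. -/
def testMul (g : Smooth (Q n)) : Test n →L[ℂ] Test n :=
  TestFunction.limitCLM ℂ
    (fun ψ => ⟨fun x => g x * ψ x, ContDiff.mul g.contDiff ψ.contDiff,
      ψ.hasCompactSupport.mul_left, fun _ _ => trivial⟩)
    (fun K hK => (TestFunction.ofSupportedInCLM ℂ hK).comp
      (ContDiffMapSupportedIn.bilinLeftCLM (ContinuousLinearMap.mul ℂ ℂ) (g := g) g.contDiff))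
    (fun K hK ψ => by ext x; exact mul_comm _ _)

@[simp]
theorem testMul_apply (g : Smooth (Q n)) (ψ : Test n) (x : Q n) :
    testMul g ψ x = g x * ψ x := rfl

namespace Distr

@[ext]
theorem ext {u v : Distr n} (h : ∀ ψ, u ψ = v ψ) : u = v := DFunLike.ext u v h

@[simp] theorem zero_apply (ψ : Test n) : (0 : Distr n) ψ = 0 := rfl
@[simp] theorem add_apply (u v : Distr n) (ψ : Test n) : (u + v) ψ = u ψ + v ψ := rfl
@[simp] theorem neg_apply (u : Distr n) (ψ : Test n) : (-u) ψ = -u ψ := rfl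
@[simp] theorem sub_apply (u v : Distr n) (ψ : Test n) : (u - v) ψ = u ψ - v ψ := rfl
@[simp] theorem smul_apply (c : ℂ) (u : Distr n) (ψ : Test n) : (c • u) ψ = c * u ψ := rfl

end Distr

/-- Distributions form a module over the smooth functions: `(g u)(ψ) = u(g ψ)`. -/
instance : Module (Smooth (Q n)) (Distr n) where
  smul g u := ContinuousLinearMap.comp (M₃ := ℂ) u (testMul g)
  one_smul u := by
    ext ψ
    change u (testMul 1 ψ) = u ψ
    congr 1; ext x; simp
  mul_smul g h u := by
    ext ψ
    change u (testMul (g * h) ψ) = u (testMul h (testMul g ψ))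
    congr 1; ext x; simp; ring
  smul_zero g := by ext ψ; rfl
  smul_add g u v := by ext ψ; rfl
  add_smul g h u := by
    ext ψ
    change u (testMul (g + h) ψ) = u (testMul g ψ) + u (testMul h ψ)
    rw [← map_add]; congr 1; ext x; simp; ring
  zero_smul u := by
    ext ψ
    change u (testMul 0 ψ) = 0
    rw [← map_zero u]; congr 1; ext x; simp

theorem smul_distr_apply (g : Smooth (Q n)) (u : Distr n) (ψ : Test n) :
    (g • u) ψ = u (testMul g ψ) := rfl

instance : IsScalarTower ℂ (Smooth (Q n)) (Distr n) where
  smul_assoc c g u := by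
    ext ψ
    change u (testMul (c • g) ψ) = c • u (testMul g ψ)
    rw [← map_smul]; congr 1; ext x; simp; ring

/-- The distributional derivative `∂u/∂q^k`: `(∂_k u)(ψ) = -u(∂_k ψ)`. -/
def dDistr (k : Fin n) : Distr n →ₗ[ℂ] Distr n where
  toFun u := -(ContinuousLinearMap.comp (M₃ := ℂ) u
    (TestFunction.lineDerivCLM ℂ (basisVec k)) : Distr n)
  map_add' u v := by
    ext ψ
    exact neg_add _ _
  map_smul' c u := by
    ext ψ
    exact (mul_neg _ _).symm

theorem dDistr_apply (k : Fin n) (u : Distr n) (ψ : Test n) :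
    dDistr k u ψ = -u (TestFunction.lineDerivCLM ℂ (basisVec k) ψ) := rfl

theorem dDistr_smul (k : Fin n) (g : Smooth (Q n)) (u : Distr n) :
    dDistr k (g • u) = dirDeriv (basisVec k) g • u + g • dDistr k u := by
  ext ψ
  change -u (testMul g (TestFunction.lineDerivCLM ℂ (basisVec k) ψ)) =
    u (testMul (dirDeriv (basisVec k) g) ψ) +
      -u (TestFunction.lineDerivCLM ℂ (basisVec k) (testMul g ψ))
  rw [← sub_eq_add_neg, ← map_sub, ← map_neg]
  congr 1; ext x
  have hψ : Differentiable ℝ ψ := ψ.contDiff.differentiable (by simp)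
  have hgψ : (testMul g ψ : Q n → ℂ) = (g : Q n → ℂ) * (ψ : Q n → ℂ) := rfl
  have e1 : ∀ χ : Test n, (TestFunction.lineDerivCLM ℂ (basisVec k) χ : Test n) x
      = fderiv ℝ χ x (basisVec k) := fun χ => by
    rw [TestFunction.lineDerivCLM_eq_fderivCLM,
      TestFunction.fderivCLM_apply_of_le _ (by simp)]
  change -(g x * (TestFunction.lineDerivCLM ℂ (basisVec k) ψ : Test n) x) =
    dirDeriv (basisVec k) g x * ψ x -
      (TestFunction.lineDerivCLM ℂ (basisVec k) (testMul g ψ) : Test n) x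
  rw [e1, e1, hgψ, fderiv_mul (g.differentiable x) (hψ x), dirDeriv_apply]
  simp
  ring

/-! ### Distributions on `T*ℝⁿ` that are smooth along the fibres -/

instance : Algebra (Smooth (Q n)) (Smooth (P n)) := (piStar (n := n)).toRingHom.toAlgebra

instance : IsScalarTower ℂ (Smooth (Q n)) (Smooth (P n)) :=
  IsScalarTower.of_algebraMap_eq fun _ => rfl

/-- The `C^∞(T*ℝⁿ)`-module generated by the pull-backs `π^*u` of distributions `u` on `ℝⁿ`, with
`(π^*g) π^*u = π^*(g u)` for smooth `g`. Its elements are the finite sums `∑ F_j π^*u_j`, where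
`F π^*u` is represented by the pure tensor `F ⊗ u`. -/
def FibreDistr (n : ℕ) : Type := Smooth (P n) ⊗[Smooth (Q n)] Distr n

instance : AddCommGroup (FibreDistr n) :=
  inferInstanceAs (AddCommGroup (Smooth (P n) ⊗[Smooth (Q n)] Distr n))

instance : Module (Smooth (P n)) (FibreDistr n) :=
  inferInstanceAs (Module (Smooth (P n)) (Smooth (P n) ⊗[Smooth (Q n)] Distr n))

instance : Module ℂ (FibreDistr n) :=
  inferInstanceAs (Module ℂ (Smooth (P n) ⊗[Smooth (Q n)] Distr n))

/-- The fibrewise smooth distribution `F π^*u`. -/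
def FibreDistr.tmul (F : Smooth (P n)) (u : Distr n) : FibreDistr n := F ⊗ₜ[Smooth (Q n)] u

namespace FibreDistr

theorem smul_tmul (F G : Smooth (P n)) (u : Distr n) : F • tmul G u = tmul (F * G) u := rfl

theorem smul_tmul_complex (c : ℂ) (G : Smooth (P n)) (u : Distr n) :
    c • tmul G u = tmul (c • G) u := rfl

theorem tmul_add (F : Smooth (P n)) (u v : Distr n) : tmul F (u + v) = tmul F u + tmul F v :=
  TensorProduct.tmul_add _ _ _

theorem add_tmul (F G : Smooth (P n)) (u : Distr n) : tmul (F + G) u = tmul F u + tmul G u :=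
  TensorProduct.add_tmul _ _ _

theorem tmul_balanced (g : Smooth (Q n)) (F : Smooth (P n)) (u : Distr n) :
    tmul (g • F) u = tmul F (g • u) := TensorProduct.smul_tmul _ _ _

theorem tmul_smul (c : ℂ) (F : Smooth (P n)) (u : Distr n) :
    tmul F (c • u) = tmul (c • F) u := by
  rw [← algebraMap_smul (Smooth (Q n)) c u, ← tmul_balanced, algebraMap_smul]

theorem induction {p : FibreDistr n → Prop} (h0 : p 0) (ht : ∀ F u, p (tmul F u))
    (ha : ∀ x y, p x → p y → p (x + y)) (x : FibreDistr n) : p x :=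
  TensorProduct.induction_on x h0 ht ha

/-- A biadditive, `C^∞(ℝⁿ)`-balanced map `f(F, u)`, complex-linear in `F`, induces a complex-linear
map on fibrewise smooth distributions with `F π^*u ↦ f(F, u)`. -/
def lift {W : Type*} [AddCommGroup W] [Module ℂ W] (f : Smooth (P n) → Distr n → W)
    (hl : ∀ F G u, f (F + G) u = f F u + f G u) (hr : ∀ F u v, f F (u + v) = f F u + f F v)
    (hb : ∀ (g : Smooth (Q n)) F u, f (g • F) u = f F (g • u))
    (hc : ∀ (c : ℂ) F u, f (c • F) u = c • f F u) : FibreDistr n →ₗ[ℂ] W where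
  __ := TensorProduct.liftAddHom (R := Smooth (Q n))
    (AddMonoidHom.mk' (fun F : Smooth (P n) => AddMonoidHom.mk' (f F) (hr F))
      (fun F G => AddMonoidHom.ext (hl F G))) hb
  map_smul' c x := by
    induction x using FibreDistr.induction with
    | h0 => exact (congrArg _ (smul_zero c)).trans ((map_zero _).trans
        ((smul_zero c).symm.trans (congrArg _ (map_zero _).symm)))
    | ht F u => exact hc c F u
    | ha x y hx hy =>
      rw [smul_add]
      refine (map_add (TensorProduct.liftAddHom (R := Smooth (Q n)) _ hb) _ _).trans ?_
      refine (congrArg₂ (· + ·) hx hy).trans ?_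
      rw [← smul_add]
      exact congrArg _ (map_add (TensorProduct.liftAddHom (R := Smooth (Q n)) _ hb) _ _).symm

theorem lift_tmul {W : Type*} [AddCommGroup W] [Module ℂ W] (f : Smooth (P n) → Distr n → W)
    (hl hr hb hc) (F : Smooth (P n)) (u : Distr n) :
    lift f hl hr hb hc (tmul F u) = f F u := rfl

end FibreDistr

open FibreDistr (tmul)

/-- `π^*u` for a distribution `u` on `ℝⁿ`. -/
def piStarDistr : Distr n →ₗ[ℂ] FibreDistr n where
  toFun u := tmul 1 u
  map_add' u v := FibreDistr.tmul_add _ _ _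
  map_smul' c u := by
    rw [FibreDistr.tmul_smul, ← FibreDistr.smul_tmul_complex]; rfl

/-- Restriction to the zero section: `i^*(F π^*u) = (i^*F) u`. -/
def iStarDistr : FibreDistr n →ₗ[ℂ] Distr n :=
  FibreDistr.lift (fun F u => iStar F • u)
    (fun F G u => by rw [map_add, add_smul])
    (fun F u v => smul_add _ _ _)
    (fun g F u => by
      have : iStar (g • F) = iStar F * g := by
        rw [Algebra.smul_def, map_mul, mul_comm]; rfl
      rw [this, mul_smul])
    (fun c F u => by rw [map_smul, smul_assoc])

theorem iStarDistr_tmul (F : Smooth (P n)) (u : Distr n) :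
    iStarDistr (tmul F u) = iStar F • u := rfl

theorem dq_smul (k : Fin n) (g : Smooth (Q n)) (F : Smooth (P n)) :
    dq k (g • F) = dirDeriv (basisVec k) g • F + g • dq k F := by
  have h : dq k (piStar g) = piStar (dirDeriv (basisVec k) g) := by
    ext x
    change fderiv ℝ ((g : Q n → ℂ) ∘ Prod.fst) x _ = fderiv ℝ g x.1 _
    rw [fderiv_comp x (g.differentiable x.1) differentiableAt_fst, fderiv_fst]
    rfl
  simp only [Algebra.smul_def]
  change dq k (piStar g * F) = piStar _ * F + piStar g * dq k F
  rw [← h]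
  exact dirDeriv_mul _ _ _

theorem dp_smul (k : Fin n) (g : Smooth (Q n)) (F : Smooth (P n)) :
    dp k (g • F) = g • dp k F := by
  have h : dp k (piStar g) = 0 := by
    ext x
    change fderiv ℝ ((g : Q n → ℂ) ∘ Prod.fst) x _ = 0
    rw [fderiv_comp x (g.differentiable x.1) differentiableAt_fst, fderiv_fst]
    simp
  simp only [Algebra.smul_def]
  change dp k (piStar g * F) = piStar g * dp k F
  have := dirDeriv_mul (0, basisVec k) (piStar g) F
  change dp k (piStar g * F) = dp k (piStar g) * F + piStar g * dp k F at this
  rw [this, h, zero_mul, zero_add]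

/-- `∂/∂q^k` on fibrewise smooth distributions:
`∂_{q^k}(F π^*u) = (∂_{q^k}F) π^*u + F π^*(∂_k u)`. -/
def dqDistr (k : Fin n) : FibreDistr n →ₗ[ℂ] FibreDistr n :=
  FibreDistr.lift (fun F u => tmul (dq k F) u + tmul F (dDistr k u))
    (fun F G u => by simp only [map_add, FibreDistr.add_tmul]; abel)
    (fun F u v => by simp only [map_add, FibreDistr.tmul_add]; abel)
    (fun g F u => by
      simp only [dq_smul, dDistr_smul, FibreDistr.add_tmul, FibreDistr.tmul_add,
        FibreDistr.tmul_balanced]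
      abel)
    (fun c F u => by simp only [map_smul, ← FibreDistr.smul_tmul_complex, smul_add])

theorem dqDistr_tmul (k : Fin n) (F : Smooth (P n)) (u : Distr n) :
    dqDistr k (tmul F u) = tmul (dq k F) u + tmul F (dDistr k u) := rfl

/-- `∂/∂p_k` on fibrewise smooth distributions: `∂_{p_k}(F π^*u) = (∂_{p_k}F) π^*u`. -/
def dpDistr (k : Fin n) : FibreDistr n →ₗ[ℂ] FibreDistr n :=
  FibreDistr.lift (fun F u => tmul (dp k F) u)
    (fun F G u => by simp only [map_add, FibreDistr.add_tmul])
    (fun F u v => by simp only [FibreDistr.tmul_add])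
    (fun g F u => by simp only [dp_smul, FibreDistr.tmul_balanced])
    (fun c F u => by simp only [map_smul, ← FibreDistr.smul_tmul_complex])

theorem dpDistr_tmul (k : Fin n) (F : Smooth (P n)) (u : Distr n) :
    dpDistr k (tmul F u) = tmul (dp k F) u := rfl

/-- `Δ = ∑_k ∂²/∂q^k∂p_k` on fibrewise smooth distributions. -/
def lap : FibreDistr n →ₗ[ℂ] FibreDistr n := ∑ k : Fin n, dqDistr k ∘ₗ dpDistr k

/-- The Poisson bracket `{F, u} = ∑_k (∂_{q^k}F ∂_{p_k}u - ∂_{p_k}F ∂_{q^k}u)`. -/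
def poisson (F : Smooth (P n)) (u : FibreDistr n) : FibreDistr n :=
  ∑ k : Fin n, (dq k F • dpDistr k u - dp k F • dqDistr k u)

/-! ### The Weyl star product on formal Laurent series -/

section Weyl

variable {V : Type*} [AddCommGroup V] [Module ℂ V] [Module (Smooth (P n)) V]

/-- The bidifferential operators of the Weyl product,
`M_b(f, v) = (∑_k (∂_{q^k} ∂_{p'_k} - ∂_{p_k} ∂_{q'^k}))^b (f(q,p) v(q',p')) |_{q = q', p = p'}`,
for a function `f` and for `v` in a module `V` over the functions which carries derivatives
`dqV k = ∂_{q^k}` and `dpV k = ∂_{p_k}` (here: smooth functions, or fibrewise smooth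
distributions). -/
def weylM (dqV dpV : Fin n → V →ₗ[ℂ] V) : ℕ → Smooth (P n) → V → V
  | 0, f, v => f • v
  | b + 1, f, v =>
    ∑ k : Fin n, (weylM dqV dpV b (dq k f) (dpV k v) - weylM dqV dpV b (dp k f) (dqV k v))

theorem weylM_zero_left (dqV dpV : Fin n → V →ₗ[ℂ] V) (b : ℕ) (v : V) :
    weylM dqV dpV b 0 v = 0 := by
  induction b generalizing v with
  | zero => simp [weylM]
  | succ b ih => simp [weylM, ih]

theorem weylM_zero_right (dqV dpV : Fin n → V →ₗ[ℂ] V) (b : ℕ) (f : Smooth (P n)) :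
    weylM dqV dpV b f 0 = 0 := by
  induction b generalizing f with
  | zero => simp [weylM]
  | succ b ih => simp [weylM, ih]

/-- The Weyl product `f * v = ∑_b (iλ/2)^b / b! M_b(f, v)` of Laurent series in `λ`. -/
def weylStar (dqV dpV : Fin n → V →ₗ[ℂ] V) (f : HahnSeries ℤ (Smooth (P n)))
    (v : HahnSeries ℤ V) : HahnSeries ℤ V :=
  HahnSeries.ofSuppBddBelow
    (fun m => ∑ᶠ x : ℕ × ℤ, ((Complex.I / 2) ^ x.1 / (x.1.factorial : ℂ)) •
      weylM dqV dpV x.1 (f.coeff x.2) (v.coeff (m - x.1 - x.2)))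
    ⟨f.order + v.order, fun m hm => by
      by_contra hlt
      refine hm (finsum_eq_zero_of_forall_eq_zero fun x => ?_)
      by_cases hf : f.coeff x.2 = 0
      · rw [hf, weylM_zero_left, smul_zero]
      by_cases hv : v.coeff (m - x.1 - x.2) = 0
      · rw [hv, weylM_zero_right, smul_zero]
      have h1 := HahnSeries.order_le_of_coeff_ne_zero hf
      have h2 := HahnSeries.order_le_of_coeff_ne_zero hv
      omega⟩

/-- The action `u ↦ ∑_r λ^r D_r u` on Laurent series of a formal power series `∑_r λ^r D_r` of
linear operators. -/
def formalOp (D : ℕ → V →ₗ[ℂ] V) (u : HahnSeries ℤ V) : HahnSeries ℤ V :=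
  HahnSeries.ofSuppBddBelow (fun m => ∑ᶠ r : ℕ, D r (u.coeff (m - r)))
    ⟨u.order, fun m hm => by
      by_contra hlt
      refine hm (finsum_eq_zero_of_forall_eq_zero fun r => ?_)
      by_cases hu : u.coeff (m - r) = 0
      · rw [hu, map_zero]
      have h1 := HahnSeries.order_le_of_coeff_ne_zero hu
      omega⟩

end Weyl

/-- The Weyl star product of `C^∞(T*ℝⁿ)((λ))`. -/
def weylProd (f g : HahnSeries ℤ (Smooth (P n))) : HahnSeries ℤ (Smooth (P n)) :=
  weylStar dq dp f g

/-- The operator `𝒮 = exp(-(iλ/2) Δ)`. -/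
def calS (u : HahnSeries ℤ (FibreDistr n)) : HahnSeries ℤ (FibreDistr n) :=
  formalOp (fun a => ((-Complex.I / 2) ^ a / (a.factorial : ℂ)) • lap ^ a) u

/-- The representation `π₀(f)φ = i^* 𝒮 (f * π^*φ)`, for `f ∈ C^∞(T*ℝⁿ)((λ))` and
`φ ∈ C_0^∞(ℝⁿ)'((λ))`. -/
def piZero (f : HahnSeries ℤ (Smooth (P n))) (φ : HahnSeries ℤ (Distr n)) :
    HahnSeries ℤ (Distr n) :=
  (calS (weylStar dqDistr dpDistr f (φ.map piStarDistr))).map iStarDistr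

/-- The formal power series `∑_{r ≥ 0} λ^r φ_r`. -/
def formalSeries {V : Type*} [Zero V] (φ : ℕ → V) : HahnSeries ℤ V :=
  HahnSeries.ofSuppBddBelow (fun m => if 0 ≤ m then φ m.toNat else 0)
    ⟨0, fun m hm => by
      by_contra h
      exact hm (if_neg h)⟩

/-! ### The Heisenberg equation of `π^*S` -/

/-- `π^*S`, as a Laurent series which is constant in `λ`. -/
def piS (S : RealSmooth (Q n)) : HahnSeries ℤ (Smooth (P n)) :=
  HahnSeries.single 0 (piStar (complexify S))

/-- The constant `i/λ`. -/
def iOverLambda (n : ℕ) : HahnSeries ℤ (Smooth (P n)) :=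
  HahnSeries.single (-1) (algebraMap ℂ (Smooth (P n)) Complex.I)

/-- `t ↦ f(t)` is a smooth curve in `C^∞(T*ℝⁿ)((λ))` which solves the Heisenberg equation
`df/dt = (i/λ) ((π^*S) * f(t) - f(t) * (π^*S))`. -/
structure IsHeisenbergSolution (S : RealSmooth (Q n)) (f : ℝ → HahnSeries ℤ (Smooth (P n))) :
    Prop where
  /-- Locally in `t`, the principal parts are uniformly finite. -/
  bddBelow : ∀ t₀ : ℝ, ∃ N : ℤ, ∀ᶠ t in 𝓝 t₀, ∀ m < N, (f t).coeff m = 0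
  smooth : ∀ m : ℤ, ContDiff ℝ ∞ fun z : ℝ × P n => (f z.1).coeff m z.2
  eqn : ∀ (t : ℝ) (m : ℤ) (x : P n),
    HasDerivAt (fun s => (f s).coeff m x)
      ((iOverLambda n * (weylProd (piS S) (f t) - weylProd (f t) (piS S))).coeff m x) t

/-- `A_t` is the flow of the Heisenberg equation: `t ↦ A_t f₀` solves it, with initial value `f₀`. -/
def IsHeisenbergFlow (S : RealSmooth (Q n))
    (A : ℝ → HahnSeries ℤ (Smooth (P n)) → HahnSeries ℤ (Smooth (P n))) : Prop :=
  ∀ f₀, A 0 f₀ = f₀ ∧ IsHeisenbergSolution S fun t => A t f₀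

/-- The factorization `A_t = Φ_t^* ∘ T_t` with `T_t = 1 + ∑_{r ≥ 1} λ^r T_t^{(r)}`, where the
`T_t^{(r)} = T t r` are differential operators on `T*ℝⁿ`. -/
structure IsFactorization (S : RealSmooth (Q n))
    (A : ℝ → HahnSeries ℤ (Smooth (P n)) → HahnSeries ℤ (Smooth (P n)))
    (T : ℝ → ℕ → Module.End ℂ (Smooth (P n))) : Prop where
  zero : ∀ t, T t 0 = 1
  diffOp : ∀ t r, T t r ∈ diffOps n
  factor : ∀ t f, A t f = (formalOp (T t) f).map (flowStar S t)

end FormalWKB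

end

open FormalWKB

namespace FormalWKB

variable {n : ℕ}

/-! ### Coefficients of formal operators and of the Weyl product -/

section Coefficients

/-! Since `π^*S` does not depend on `p`, only `p`-derivatives fall on the other factor, and
`M_b(π^*S, f)` and `M_b(f, π^*S)` differ by the sign `(-1)^b`. Hence `(i/λ)[π^*S, ·] = ∑_{a ≥ 0} λ^a
L_a` (`heisenberg_rhs`), where each `L_a` differentiates along the fibres only and has coefficients
depending on `q` alone. The operator `L_0 = -∑_k ∂_kS ∂_{p_k}` generates `Φ_t^*`, and every `L_a`
commutes with the fibre translation `Φ_t^*` (`heisenbergOp_flowStar`).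

Existence: put `T_t = exp(t ∑_{a ≥ 1} λ^a L_a)`. The exponent has no constant term, so each
coefficient is a polynomial in `t` with differential operators as coefficients, and `Φ_t^* T_t`
solves the equation (`hasDerivAt_transportOp_flow`). Uniqueness: for a solution with zero initial
value, induction on the order in `λ` leaves at each order the transport equation of `L_0`, whose
solutions are constant along characteristics (`IsHeisenbergSolution.eq_zero`). The factorization is
unique because `Φ_t^*` is injective and `T_t` can be read off from its values on series constant in
`λ`.

Schrödinger equation: write `A_{-1}H = ∑ λ^r F_r`. The Hamilton–Jacobi equation says `i^*F_0 = E`.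
In order `r + 1` of `π₀(A_{-1}H)φ = Eφ` the term with `φ_{r+1}` therefore cancels, the three terms
with `φ_r` form the left side of the recursion, and the terms with `φ_d`, `d < r`, form its right
side (`coeff_piZero_succ`). Order `0` holds automatically. -/

theorem exists_coeff_eq_zero_below {V : Type*} [Zero V] (u : HahnSeries ℤ V) :
    ∃ N : ℤ, ∀ m < N, u.coeff m = 0 :=
  ⟨u.order, fun _ hm => HahnSeries.coeff_eq_zero_of_lt_order hm⟩

/-- A common lower bound `N` replaces integer exponents by natural numbers `k`; at exponent `N + k`
the `finsum`s of the definitions become finite sums over antidiagonals. -/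
theorem hahnSeries_eq_of_below {V : Type*} [Zero V] {u v : HahnSeries ℤ V} {N : ℤ}
    (hu : ∀ m < N, u.coeff m = 0) (hv : ∀ m < N, v.coeff m = 0)
    (h : ∀ k : ℕ, u.coeff (N + k) = v.coeff (N + k)) : u = v := by
  ext m
  rcases lt_or_ge m N with hm | hm
  · rw [hu m hm, hv m hm]
  · obtain ⟨k, rfl⟩ := Int.le.dest hm
    exact h k

variable {V : Type*} [AddCommGroup V] [Module ℂ V]

theorem coeff_formalOp (D : ℕ → V →ₗ[ℂ] V) (u : HahnSeries ℤ V) (m : ℤ) :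
    (formalOp D u).coeff m = ∑ᶠ r : ℕ, D r (u.coeff (m - r)) := rfl

theorem coeff_formalOp_below (D : ℕ → V →ₗ[ℂ] V) {u : HahnSeries ℤ V} {N : ℤ}
    (hu : ∀ m < N, u.coeff m = 0) : ∀ m < N, (formalOp D u).coeff m = 0 := by
  intro m hm
  rw [coeff_formalOp]
  refine finsum_eq_zero_of_forall_eq_zero fun r => ?_
  rw [hu _ (by omega), map_zero]

theorem coeff_formalOp_add (D : ℕ → V →ₗ[ℂ] V) {u : HahnSeries ℤ V} {N : ℤ}
    (hu : ∀ m < N, u.coeff m = 0) (k : ℕ) :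
    (formalOp D u).coeff (N + k) =
      ∑ x ∈ Finset.HasAntidiagonal.antidiagonal k, D x.1 (u.coeff (N + x.2)) := by
  rw [coeff_formalOp, finsum_eq_sum_of_support_subset (s := Finset.range (k + 1)),
    Finset.Nat.sum_antidiagonal_eq_sum_range_succ (fun a b => D a (u.coeff (N + b)))]
  · refine Finset.sum_congr rfl fun a ha => ?_
    have : a ≤ k := Finset.mem_range_succ_iff.1 ha
    rw [Nat.cast_sub this, add_sub_assoc]
  · intro a ha
    by_contra hk
    refine ha ?_
    have : ¬ a < k + 1 := by simpa using hk
    simp only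
    rw [hu _ (by omega), map_zero]

theorem coeff_formalOp_single (D : ℕ → V →ₗ[ℂ] V) (v : V) (r : ℕ) :
    (formalOp D (HahnSeries.single 0 v)).coeff r = D r v := by
  have h := coeff_formalOp_add D (u := HahnSeries.single 0 v) (N := 0)
    (fun m hm => HahnSeries.coeff_single_of_ne hm.ne) r
  rw [zero_add] at h
  rw [h, Finset.sum_eq_single (r, 0)]
  · simp
  · rintro ⟨a, b⟩ hab hne
    rw [Finset.HasAntidiagonal.mem_antidiagonal] at hab
    have hb : (b : ℤ) ≠ 0 := by
      rintro hb
      simp only [Nat.cast_eq_zero] at hb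
      subst hb
      exact hne (by simpa using hab)
    rw [zero_add, HahnSeries.coeff_single_of_ne hb, map_zero]
  · simp

theorem formalOp_sub (D : ℕ → V →ₗ[ℂ] V) (u v : HahnSeries ℤ V) :
    formalOp D (u - v) = formalOp D u - formalOp D v := by
  obtain ⟨N₁, h₁⟩ := exists_coeff_eq_zero_below u
  obtain ⟨N₂, h₂⟩ := exists_coeff_eq_zero_below v
  have hu : ∀ m < min N₁ N₂, u.coeff m = 0 := fun m hm => h₁ m (by omega)
  have hv : ∀ m < min N₁ N₂, v.coeff m = 0 := fun m hm => h₂ m (by omega)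
  have huv : ∀ m < min N₁ N₂, (u - v).coeff m = 0 := fun m hm => by
    rw [HahnSeries.coeff_sub, hu m hm, hv m hm, sub_zero]
  refine hahnSeries_eq_of_below (coeff_formalOp_below D huv) (fun m hm => ?_) fun k => ?_
  · rw [HahnSeries.coeff_sub, coeff_formalOp_below D hu m hm, coeff_formalOp_below D hv m hm,
      sub_zero]
  · rw [HahnSeries.coeff_sub, coeff_formalOp_add D huv, coeff_formalOp_add D hu,
      coeff_formalOp_add D hv, ← Finset.sum_sub_distrib]
    simp only [HahnSeries.coeff_sub, map_sub]

theorem formalOp_formalOp (C D : ℕ → Module.End ℂ V) (u : HahnSeries ℤ V) :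
    formalOp C (formalOp D u) =
      formalOp (fun r => ∑ x ∈ Finset.HasAntidiagonal.antidiagonal r, C x.1 * D x.2) u := by
  obtain ⟨N, hN⟩ := exists_coeff_eq_zero_below u
  have hD := coeff_formalOp_below D hN
  refine hahnSeries_eq_of_below (coeff_formalOp_below C hD) (coeff_formalOp_below _ hN)
    fun k => ?_
  rw [coeff_formalOp_add C hD, coeff_formalOp_add _ hN]
  simp only [coeff_formalOp_add D hN, map_sum, LinearMap.sum_apply, Module.End.mul_apply,
    Finset.sum_sigma']
  -- Associativity: decompositions `a + (c + d)` of `k` correspond to decompositions `(a + c) + d`.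
  refine Finset.sum_nbij' (fun x => ⟨(x.1.1 + x.2.1, x.2.2), (x.1.1, x.2.1)⟩)
    (fun x => ⟨(x.2.1, x.2.2 + x.1.2), (x.2.2, x.1.2)⟩) ?_ ?_ ?_ ?_ ?_
  · rintro ⟨⟨a, b⟩, c, d⟩ h
    simp only [Finset.mem_sigma, Finset.HasAntidiagonal.mem_antidiagonal, and_true] at h ⊢
    omega
  · rintro ⟨⟨a, b⟩, c, d⟩ h
    simp only [Finset.mem_sigma, Finset.HasAntidiagonal.mem_antidiagonal, and_true] at h ⊢
    omega
  · rintro ⟨⟨a, b⟩, c, d⟩ h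
    obtain ⟨-, h⟩ := Finset.mem_sigma.1 h
    obtain rfl : c + d = b := Finset.HasAntidiagonal.mem_antidiagonal.1 h
    rfl
  · rintro ⟨⟨a, b⟩, c, d⟩ h
    obtain ⟨-, h⟩ := Finset.mem_sigma.1 h
    obtain rfl : c + d = a := Finset.HasAntidiagonal.mem_antidiagonal.1 h
    rfl
  · intro _ _
    rfl

theorem formalOp_map (D : ℕ → Module.End ℂ V) (L : V →ₗ[ℂ] V)
    (h : ∀ r v, D r (L v) = L (D r v)) (u : HahnSeries ℤ V) :
    formalOp D (u.map L) = (formalOp D u).map L := by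
  obtain ⟨N, hN⟩ := exists_coeff_eq_zero_below u
  have hL : ∀ m < N, (u.map L).coeff m = 0 := fun m hm => by
    rw [HahnSeries.map_coeff, hN m hm, map_zero]
  refine hahnSeries_eq_of_below (coeff_formalOp_below D hL) (fun m hm => ?_) fun k => ?_
  · rw [HahnSeries.map_coeff, coeff_formalOp_below D hN m hm, map_zero]
  · rw [HahnSeries.map_coeff, coeff_formalOp_add D hL, coeff_formalOp_add D hN, map_sum]
    simp only [HahnSeries.map_coeff, h]

/-! ### Coefficients of the Weyl product and of formal power series. -/

variable [Module (Smooth (P n)) V] (dqV dpV : Fin n → V →ₗ[ℂ] V)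
  {f : HahnSeries ℤ (Smooth (P n))} {v : HahnSeries ℤ V} {M N : ℤ}

theorem coeff_weylStar (f : HahnSeries ℤ (Smooth (P n))) (v : HahnSeries ℤ V) (m : ℤ) :
    (weylStar dqV dpV f v).coeff m =
      ∑ᶠ x : ℕ × ℤ, ((Complex.I / 2) ^ x.1 / (x.1.factorial : ℂ)) •
        weylM dqV dpV x.1 (f.coeff x.2) (v.coeff (m - x.1 - x.2)) := rfl

theorem coeff_weylStar_below (hf : ∀ m < M, f.coeff m = 0) (hv : ∀ m < N, v.coeff m = 0) :
    ∀ m < M + N, (weylStar dqV dpV f v).coeff m = 0 := by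
  intro m hm
  rw [coeff_weylStar]
  refine finsum_eq_zero_of_forall_eq_zero fun x => ?_
  rcases lt_or_ge x.2 M with h | h
  · rw [hf _ h, weylM_zero_left, smul_zero]
  · rw [hv _ (by omega), weylM_zero_right, smul_zero]

theorem coeff_weylStar_add (hf : ∀ m < M, f.coeff m = 0) (hv : ∀ m < N, v.coeff m = 0) (k : ℕ) :
    (weylStar dqV dpV f v).coeff (M + N + k) =
      ∑ x ∈ Finset.HasAntidiagonal.antidiagonal k, ∑ y ∈ Finset.HasAntidiagonal.antidiagonal x.2,
        ((Complex.I / 2) ^ x.1 / (x.1.factorial : ℂ)) •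
          weylM dqV dpV x.1 (f.coeff (M + y.1)) (v.coeff (N + y.2)) := by
  classical
  rw [coeff_weylStar, Finset.sum_sigma',
    -- The support lies among the pairs `(b, M + c)` with `b + c + d = k`: exponents below `M` kill
    -- the left factor, and `d < 0` kills the right one.
    finsum_eq_sum_of_support_subset (s := ((Finset.HasAntidiagonal.antidiagonal k).sigma fun x =>
      Finset.HasAntidiagonal.antidiagonal x.2).image fun z => (z.1.1, M + (z.2.1 : ℤ)))]
  · rw [Finset.sum_image]
    · refine Finset.sum_congr rfl ?_
      rintro ⟨⟨a, b⟩, c, d⟩ h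
      simp only [Finset.mem_sigma, Finset.HasAntidiagonal.mem_antidiagonal] at h
      have : M + N + (k : ℤ) - a - (M + c) = N + d := by omega
      simp only [this]
    · rintro ⟨⟨a, b⟩, c, d⟩ h ⟨⟨a', b'⟩, c', d'⟩ h' heq
      simp only [Finset.coe_sigma, Set.mem_sigma_iff, Finset.mem_coe,
        Finset.HasAntidiagonal.mem_antidiagonal] at h h'
      simp only [Prod.mk.injEq] at heq
      obtain ⟨rfl, hc⟩ := heq
      obtain rfl : c = c' := by omega
      obtain rfl : b = b' := by omega
      obtain rfl : d = d' := by omega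
      rfl
  · rintro ⟨a, j⟩ h
    simp only [Function.mem_support] at h
    have h₁ : M ≤ j := by
      by_contra hj
      rw [hf _ (by omega), weylM_zero_left, smul_zero] at h
      exact h rfl
    have h₂ : N ≤ M + N + k - a - j := by
      by_contra hj
      rw [hv _ (by omega), weylM_zero_right, smul_zero] at h
      exact h rfl
    simp only [Finset.coe_image, Set.mem_image, Finset.mem_coe, Finset.mem_sigma,
      Finset.HasAntidiagonal.mem_antidiagonal]
    exact ⟨⟨(a, k - a), ((j - M).toNat, k - a - (j - M).toNat)⟩,
      by simp only; omega, by simp only [Prod.mk.injEq, true_and]; omega⟩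

theorem coeff_weylStar_single_left (g : Smooth (P n)) (hv : ∀ m < N, v.coeff m = 0) (k : ℕ) :
    (weylStar dqV dpV (HahnSeries.single 0 g) v).coeff (N + k) =
      ∑ x ∈ Finset.HasAntidiagonal.antidiagonal k, ((Complex.I / 2) ^ x.1 / (x.1.factorial : ℂ)) •
          weylM dqV dpV x.1 g (v.coeff (N + x.2)) := by
  have h := coeff_weylStar_add dqV dpV (f := HahnSeries.single 0 g) (M := 0)
    (fun m hm => HahnSeries.coeff_single_of_ne hm.ne) hv k
  rw [zero_add] at h
  rw [h]
  refine Finset.sum_congr rfl fun x _ => ?_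
  rw [Finset.sum_eq_single (0, x.2)]
  · simp
  · rintro ⟨a, b⟩ hab hne
    rw [Finset.HasAntidiagonal.mem_antidiagonal] at hab
    have ha : (a : ℤ) ≠ 0 := by
      intro ha
      simp only [Nat.cast_eq_zero] at ha
      subst ha
      exact hne (by simpa using hab)
    rw [zero_add, HahnSeries.coeff_single_of_ne ha, weylM_zero_left, smul_zero]
  · simp

theorem coeff_weylStar_single_right (hf : ∀ m < M, f.coeff m = 0) (w : V) (k : ℕ) :
    (weylStar dqV dpV f (HahnSeries.single 0 w)).coeff (M + k) =
      ∑ x ∈ Finset.HasAntidiagonal.antidiagonal k, ((Complex.I / 2) ^ x.1 / (x.1.factorial : ℂ)) •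
          weylM dqV dpV x.1 (f.coeff (M + x.2)) w := by
  have h := coeff_weylStar_add dqV dpV (v := HahnSeries.single 0 w) (N := 0) hf
    (fun m hm => HahnSeries.coeff_single_of_ne hm.ne) k
  rw [add_zero] at h
  rw [h]
  refine Finset.sum_congr rfl fun x _ => ?_
  rw [Finset.sum_eq_single (x.2, 0)]
  · simp
  · rintro ⟨a, b⟩ hab hne
    rw [Finset.HasAntidiagonal.mem_antidiagonal] at hab
    have hb : (b : ℤ) ≠ 0 := by
      intro hb
      simp only [Nat.cast_eq_zero] at hb
      subst hb
      exact hne (by simpa using hab)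
    rw [zero_add, HahnSeries.coeff_single_of_ne hb, weylM_zero_right, smul_zero]
  · simp

theorem coeff_formalSeries {V : Type*} [Zero V] (φ : ℕ → V) (k : ℕ) :
    (formalSeries φ).coeff k = φ k := by
  change (if (0 : ℤ) ≤ k then φ (k : ℤ).toNat else 0) = φ k
  rw [if_pos (Int.natCast_nonneg k), Int.toNat_natCast]

theorem coeff_formalSeries_below {V : Type*} [Zero V] (φ : ℕ → V) :
    ∀ m < (0 : ℤ), (formalSeries φ).coeff m = 0 := fun m hm => if_neg (by omega)

end Coefficients

/-! ### Fibrewise differential operators and the Heisenberg equation -/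

theorem dq_piStar (k : Fin n) (g : Smooth (Q n)) :
    dq k (piStar g) = piStar (dirDeriv (basisVec k) g) := by
  ext x
  change fderiv ℝ ((g : Q n → ℂ) ∘ Prod.fst) x _ = fderiv ℝ g x.1 _
  rw [fderiv_comp x (g.differentiable x.1) differentiableAt_fst, fderiv_fst]
  rfl

theorem dp_piStar (k : Fin n) (g : Smooth (Q n)) : dp k (piStar g) = 0 := by
  ext x
  change fderiv ℝ ((g : Q n → ℂ) ∘ Prod.fst) x _ = 0
  rw [fderiv_comp x (g.differentiable x.1) differentiableAt_fst, fderiv_fst]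
  simp

/-- The operator `∑ (∂_{q^{k_1}} ⋯ ∂_{q^{k_b}} g) ∂_{p_{k_1}} ⋯ ∂_{p_{k_b}}`. -/
noncomputable def fibreOp : ℕ → Smooth (Q n) → Module.End ℂ (Smooth (P n))
  | 0, g => LinearMap.mulLeft ℂ (piStar g)
  | b + 1, g => ∑ k : Fin n, fibreOp b (dirDeriv (basisVec k) g) * dp k

theorem fibreOp_mem_diffOps (b : ℕ) (g : Smooth (Q n)) : fibreOp b g ∈ diffOps n := by
  induction b generalizing g with
  | zero => exact Algebra.subset_adjoin (Or.inl (Or.inl ⟨_, rfl⟩))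
  | succ b ih =>
    exact sum_mem fun k _ => mul_mem (ih _) (Algebra.subset_adjoin (Or.inr ⟨k, rfl⟩))

theorem weylM_piStar_left (b : ℕ) (g : Smooth (Q n)) (f : Smooth (P n)) :
    weylM dq dp b (piStar g) f = fibreOp b g f := by
  induction b generalizing g f with
  | zero => rfl
  | succ b ih =>
    simp only [weylM, fibreOp, dq_piStar, dp_piStar, weylM_zero_left, sub_zero, ih,
      LinearMap.sum_apply, Module.End.mul_apply]

/-- The sign comes from the antisymmetry of the Poisson tensor: each of the `b` steps uses the
summand `-∂_{p_k} ⊗ ∂_{q^k}`, as the other one differentiates `π^*g` in `p`. -/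
theorem weylM_piStar_right (b : ℕ) (g : Smooth (Q n)) (f : Smooth (P n)) :
    weylM dq dp b f (piStar g) = (-1 : ℂ) ^ b • fibreOp b g f := by
  induction b generalizing g f with
  | zero =>
    rw [pow_zero, one_smul]
    exact mul_comm _ _
  | succ b ih =>
    simp only [weylM, fibreOp, dq_piStar, dp_piStar, weylM_zero_right, zero_sub, ih,
      LinearMap.sum_apply, Module.End.mul_apply, Finset.smul_sum, pow_succ, mul_neg, mul_one,
      neg_smul]

/-- The coefficients of the operator `f ↦ (i/λ) ((π^*S) * f - f * (π^*S))`. -/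
noncomputable def heisenbergOp (S : RealSmooth (Q n)) (a : ℕ) : Module.End ℂ (Smooth (P n)) :=
  (Complex.I * ((Complex.I / 2) ^ (a + 1) / ((a + 1).factorial : ℂ) * (1 - (-1) ^ (a + 1)))) •
    fibreOp (a + 1) (complexify S)

theorem heisenbergOp_zero (S : RealSmooth (Q n)) :
    heisenbergOp S 0 = -fibreOp 1 (complexify S) := by
  rw [heisenbergOp, ← neg_one_smul ℂ (fibreOp 1 (complexify S))]
  congr 1
  norm_num

theorem heisenbergOp_mem_diffOps (S : RealSmooth (Q n)) (a : ℕ) :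
    heisenbergOp S a ∈ diffOps n :=
  Subalgebra.smul_mem _ (fibreOp_mem_diffOps _ _) _

/-- The commutator has the factor `1 - (-1)^b` at `M_b`, so its `b = 0` term vanishes. This absorbs
the factor `1/λ` and shifts the index to `b = a + 1`; no negative powers of `λ` are left. -/
theorem heisenberg_rhs (S : RealSmooth (Q n)) (f : HahnSeries ℤ (Smooth (P n))) :
    iOverLambda n * (weylProd (piS S) f - weylProd f (piS S)) =
      formalOp (heisenbergOp S) f := by
  obtain ⟨N, hN⟩ := exists_coeff_eq_zero_below f
  have hS : ∀ m < (0 : ℤ), (piS S).coeff m = 0 := fun m hm =>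
    HahnSeries.coeff_single_of_ne hm.ne
  have hc : ∀ m < N, (weylProd (piS S) f - weylProd f (piS S)).coeff m = 0 := fun m hm => by
    rw [HahnSeries.coeff_sub, weylProd, weylProd, coeff_weylStar_below dq dp hS hN m (by omega),
      coeff_weylStar_below dq dp hN hS m (by omega), sub_zero]
  have hk : ∀ k : ℕ, (weylProd (piS S) f - weylProd f (piS S)).coeff (N + k) =
      ∑ x ∈ Finset.HasAntidiagonal.antidiagonal k,
        ((Complex.I / 2) ^ x.1 / (x.1.factorial : ℂ) * (1 - (-1) ^ x.1)) •
          fibreOp x.1 (complexify S) (f.coeff (N + x.2)) := fun k => by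
    rw [HahnSeries.coeff_sub, weylProd, weylProd, piS, coeff_weylStar_single_left dq dp _ hN,
      coeff_weylStar_single_right dq dp hN, ← Finset.sum_sub_distrib]
    refine Finset.sum_congr rfl fun x _ => ?_
    rw [weylM_piStar_left, weylM_piStar_right, smul_smul, ← sub_smul]
    congr 1
    ring
  have hm : ∀ m : ℤ, (iOverLambda n * (weylProd (piS S) f - weylProd f (piS S))).coeff m =
      Complex.I • (weylProd (piS S) f - weylProd f (piS S)).coeff (m + 1) := fun m => by
    rw [iOverLambda, HahnSeries.coeff_single_mul, sub_neg_eq_add, Algebra.smul_def]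
  refine hahnSeries_eq_of_below (N := N) (fun m hmN => ?_) (coeff_formalOp_below _ hN)
    fun k => ?_
  · rw [hm]
    -- The factor `1/λ` could create a coefficient at exponent `N - 1`; it is the lowest commutator
    -- coefficient, which has only the vanishing term `b = 0`.
    rcases (show m + 1 ≤ N from hmN).lt_or_eq with h | h
    · rw [hc _ h, smul_zero]
    · have := hk 0
      simp only [Nat.cast_zero, add_zero, Finset.Nat.antidiagonal_zero, Finset.sum_singleton,
        pow_zero, sub_self, mul_zero, zero_smul] at this
      rw [h, this, smul_zero]
  · have := hk (k + 1)
    rw [Finset.Nat.sum_antidiagonal_succ] at this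
    rw [hm, coeff_formalOp_add _ hN, add_assoc]
    push_cast at this
    rw [this, pow_zero (-1 : ℂ), sub_self, mul_zero, zero_smul, zero_add, Finset.smul_sum]
    refine Finset.sum_congr rfl fun x _ => ?_
    rw [smul_smul]
    rfl

/-! ### The flow and the fibrewise operators -/

theorem dp_flowStar (S : RealSmooth (Q n)) (t : ℝ) (k : Fin n) (f : Smooth (P n)) :
    dp k (flowStar S t f) = flowStar S t (dp k f) := by
  ext x
  have h₁ : HasFDerivAt (flow S t) (fderiv ℝ (flow S t) x) x :=
    ((contDiff_flow S t).differentiable (by simp) x).hasFDerivAt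
  have h₂ : fderiv ℝ (flow S t) x (0, basisVec k) = (0, basisVec k) := by
    -- The differential of the flow on a vertical vector is computed along a vertical line, which
    -- the flow translates rigidly because `dS(q)` is constant on it.
    have h₃ : HasDerivAt (fun s : ℝ => x + s • ((0, basisVec k) : P n)) (0, basisVec k) 0 := by
      simpa using ((hasDerivAt_id (0 : ℝ)).smul_const ((0, basisVec k) : P n)).const_add x
    have h₄ : HasFDerivAt (flow S t) (fderiv ℝ (flow S t) x)
        (x + (0 : ℝ) • ((0, basisVec k) : P n)) := by simpa using h₁
    have h₅ : (flow S t ∘ fun s : ℝ => x + s • ((0, basisVec k) : P n)) =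
        fun s : ℝ => flow S t x + s • ((0, basisVec k) : P n) := by
      funext s
      ext i <;> simp [flow]
      ring
    have h₆ := h₄.comp_hasDerivAt 0 h₃
    rw [h₅] at h₆
    refine h₆.unique ?_
    simpa using ((hasDerivAt_id (0 : ℝ)).smul_const ((0, basisVec k) : P n)).const_add (flow S t x)
  change fderiv ℝ ((f : P n → ℂ) ∘ flow S t) x _ = fderiv ℝ f (flow S t x) _
  rw [fderiv_comp x (f.differentiable _) h₁.differentiableAt, ContinuousLinearMap.comp_apply, h₂]

/-- The flow covers the identity of the base, so coefficients pulled back from the base are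
invariant, and `∂_{p_k}` commutes with translations of the fibre. -/
theorem fibreOp_flowStar (S : RealSmooth (Q n)) (t : ℝ) (b : ℕ) (g : Smooth (Q n))
    (f : Smooth (P n)) :
    fibreOp b g (flowStar S t f) = flowStar S t (fibreOp b g f) := by
  induction b generalizing g f with
  | zero => exact (map_mul (flowStar S t) (piStar g) f).symm
  | succ b ih =>
    simp only [fibreOp, LinearMap.sum_apply, Module.End.mul_apply, dp_flowStar, ih, map_sum]

theorem heisenbergOp_flowStar (S : RealSmooth (Q n)) (t : ℝ) (a : ℕ) (f : Smooth (P n)) :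
    heisenbergOp S a (flowStar S t f) = flowStar S t (heisenbergOp S a f) := by
  rw [heisenbergOp, LinearMap.smul_apply, LinearMap.smul_apply, fibreOp_flowStar, map_smul]

theorem sum_apply {ι E : Type*} [NormedAddCommGroup E] [NormedSpace ℝ E] (s : Finset ι)
    (f : ι → Smooth E) (x : E) : (∑ i ∈ s, f i) x = ∑ i ∈ s, f i x := by
  classical
  induction s using Finset.induction_on with
  | empty => rfl
  | insert i s hi ih => rw [Finset.sum_insert hi, Finset.sum_insert hi, Smooth.add_apply, ih]

theorem fibreOp_one_apply (S : RealSmooth (Q n)) (f : Smooth (P n)) (x : P n) :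
    fibreOp 1 (complexify S) f x = fderiv ℝ f x (0, dCov S x.1) := by
  have h : ((0, dCov S x.1) : P n) = ∑ k, dCov S x.1 k • ((0, basisVec k) : P n) := by
    rw [Prod.ext_iff, Prod.fst_sum, Prod.snd_sum]
    constructor
    · simp
    · ext i
      simp [basisVec, Pi.single_apply]
  have hS : ∀ k, dirDeriv (basisVec k) (complexify S) x.1 = (dCov S x.1 k : ℂ) := fun k => by
    have h₁ : HasFDerivAt S.1 (fderiv ℝ S.1 x.1) x.1 :=
      (S.2.differentiable (by simp) x.1).hasFDerivAt
    have h₂ : HasFDerivAt (complexify S) (Complex.ofRealCLM.comp (fderiv ℝ S.1 x.1)) x.1 :=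
      Complex.ofRealCLM.hasFDerivAt.comp x.1 h₁
    rw [dirDeriv_apply, h₂.fderiv]
    rfl
  rw [h, map_sum, fibreOp, LinearMap.sum_apply, sum_apply]
  refine Finset.sum_congr rfl fun k _ => ?_
  rw [map_smul, Complex.real_smul, ← hS]
  rfl

theorem hasDerivAt_flow_apply (S : RealSmooth (Q n)) (t : ℝ) (x : P n) :
    HasDerivAt (fun s => flow S s x) (0, -dCov S x.1) t := by
  have := (hasDerivAt_const t x.1).prodMk
    ((hasDerivAt_const t x.2).sub ((hasDerivAt_id t).smul_const (dCov S x.1)))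
  simpa [flow] using this

theorem heisenbergOp_zero_apply (S : RealSmooth (Q n)) (f : Smooth (P n)) (x : P n) :
    heisenbergOp S 0 f x = fderiv ℝ f x (0, -dCov S x.1) := by
  rw [heisenbergOp_zero, LinearMap.neg_apply, Smooth.neg_apply, fibreOp_one_apply, ← map_neg,
    Prod.neg_mk, neg_zero]

/-- The Heisenberg equation gives the time derivative at a fixed point only; joint differentiability
turns it into the total derivative along a moving point. -/
theorem hasDerivAt_comp_graph {E : Type*} [NormedAddCommGroup E] [NormedSpace ℝ E]
    {G : ℝ × E → ℂ} (hG : Differentiable ℝ G) {γ : ℝ → E} {v : E} {a : ℂ} {t : ℝ}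
    (hγ : HasDerivAt γ v t) (ha : HasDerivAt (fun s => G (s, γ t)) a t) :
    HasDerivAt (fun s => G (s, γ s)) (a + fderiv ℝ (fun y => G (t, y)) (γ t) v) t := by
  have hd := (hG (t, γ t)).hasFDerivAt
  have h₁ := hd.comp_hasDerivAt t ((hasDerivAt_id t).prodMk hγ)
  have h₂ := hd.comp_hasDerivAt t ((hasDerivAt_id t).prodMk (hasDerivAt_const t (γ t)))
  have h₃ := hd.comp (γ t) (hasFDerivAt_prodMk_right t (γ t))
  have h₄ : fderiv ℝ (fun y => G (t, y)) (γ t) = _ := h₃.fderiv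
  refine h₁.congr_deriv ?_
  -- The given time derivative must be the differential of `G` applied to `(1, 0)`.
  rw [ha.unique h₂, h₄, ContinuousLinearMap.comp_apply, ← map_add]
  simp

theorem contDiff_flow_uncurry (S : RealSmooth (Q n)) :
    ContDiff ℝ ∞ fun z : ℝ × P n => flow S z.1 z.2 := by
  have h : ContDiff ℝ ∞ fun z : ℝ × P n => dCov S z.2.1 :=
    (contDiff_dCov S).comp (contDiff_fst.comp contDiff_snd)
  exact (contDiff_fst.comp contDiff_snd).prodMk
    ((contDiff_snd.comp contDiff_snd).sub (contDiff_fst.smul h))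

theorem flow_flow_neg (S : RealSmooth (Q n)) (t : ℝ) (x : P n) :
    flow S t (flow S (-t) x) = x := by
  ext i <;> simp [flow]

theorem flow_neg_flow (S : RealSmooth (Q n)) (t : ℝ) (x : P n) :
    flow S (-t) (flow S t x) = x := by
  ext i <;> simp [flow]

theorem flowStar_injective (S : RealSmooth (Q n)) (t : ℝ) :
    Function.Injective (flowStar S t) := fun f g h => by
  ext x
  have h₁ : flowStar S t f (flow S (-t) x) = flowStar S t g (flow S (-t) x) := by rw [h]
  change f (flow S t (flow S (-t) x)) = g (flow S t (flow S (-t) x)) at h₁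
  rwa [flow_flow_neg] at h₁

/-! ### The transport operators -/

/-- The power series `∑_{a ≥ 1} λ^a L_a`, where `L_a` are the coefficients of the Heisenberg
operator. -/
noncomputable def correctionSeries (S : RealSmooth (Q n)) :
    PowerSeries (Module.End ℂ (Smooth (P n))) :=
  PowerSeries.mk fun a => if a = 0 then 0 else heisenbergOp S a

theorem coeff_correctionSeries_pow_mem (S : RealSmooth (Q n)) (j r : ℕ) :
    PowerSeries.coeff r (correctionSeries S ^ j) ∈ diffOps n := by
  induction j generalizing r with
  | zero =>
    rw [pow_zero, PowerSeries.coeff_one]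
    split_ifs
    · exact one_mem _
    · exact zero_mem _
  | succ j ih =>
    rw [pow_succ', PowerSeries.coeff_mul]
    refine sum_mem fun x _ => mul_mem ?_ (ih _)
    rw [correctionSeries, PowerSeries.coeff_mk]
    split_ifs
    · exact zero_mem _
    · exact heisenbergOp_mem_diffOps _ _

/-- The constant term is zero, so the `j`-th power starts at `λ^j`. This makes every coefficient of
the exponential a finite sum. -/
theorem coeff_correctionSeries_pow_eq_zero (S : RealSmooth (Q n)) {j r : ℕ} (h : r < j) :
    PowerSeries.coeff r (correctionSeries S ^ j) = 0 := by
  induction j generalizing r with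
  | zero => omega
  | succ j ih =>
    rw [pow_succ', PowerSeries.coeff_mul]
    refine Finset.sum_eq_zero fun x hx => ?_
    rw [Finset.HasAntidiagonal.mem_antidiagonal] at hx
    rcases Nat.eq_zero_or_pos x.1 with h₀ | h₀
    · rw [correctionSeries, PowerSeries.coeff_mk, if_pos h₀, zero_mul]
    · rw [ih (by omega), mul_zero]

/-- The coefficients of `exp(t ∑_{a ≥ 1} λ^a L_a)`. -/
noncomputable def transportOp (S : RealSmooth (Q n)) (t : ℝ) (r : ℕ) :
    Module.End ℂ (Smooth (P n)) :=
  ∑ j ∈ Finset.range (r + 1), ((t : ℂ) ^ j / (j.factorial : ℂ)) •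
    PowerSeries.coeff r (correctionSeries S ^ j)

/-- A cut-off independent of `r` allows coefficients of different orders to be summed over one
common range. -/
theorem transportOp_eq_sum_range (S : RealSmooth (Q n)) (t : ℝ) {r K : ℕ} (h : r < K) :
    transportOp S t r = ∑ j ∈ Finset.range K, ((t : ℂ) ^ j / (j.factorial : ℂ)) •
      PowerSeries.coeff r (correctionSeries S ^ j) := by
  refine Finset.sum_subset (Finset.range_subset_range.2 h) fun j _ hj => ?_
  rw [coeff_correctionSeries_pow_eq_zero S (by simpa using hj), smul_zero]

theorem transportOp_mem_diffOps (S : RealSmooth (Q n)) (t : ℝ) (r : ℕ) :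
    transportOp S t r ∈ diffOps n :=
  sum_mem fun j _ => Subalgebra.smul_mem _ (coeff_correctionSeries_pow_mem S j r) _

theorem transportOp_zero_right (S : RealSmooth (Q n)) (t : ℝ) : transportOp S t 0 = 1 := by
  simp [transportOp]

theorem transportOp_zero_left (S : RealSmooth (Q n)) (r : ℕ) :
    transportOp S 0 r = if r = 0 then 1 else 0 := by
  rw [transportOp, Finset.sum_eq_single 0]
  · simp [PowerSeries.coeff_one]
  · intro j _ hj
    simp [hj]
  · simp

theorem transportOp_apply (S : RealSmooth (Q n)) (t : ℝ) (r : ℕ) (f : Smooth (P n)) (x : P n) :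
    transportOp S t r f x = ∑ j ∈ Finset.range (r + 1), ((t : ℂ) ^ j / (j.factorial : ℂ)) *
      PowerSeries.coeff r (correctionSeries S ^ j) f x := by
  rw [transportOp, LinearMap.sum_apply, sum_apply]
  rfl

theorem hasDerivAt_pow_div_factorial (j : ℕ) (t : ℝ) :
    HasDerivAt (fun s : ℝ => (s : ℂ) ^ (j + 1) / ((j + 1).factorial : ℂ))
      ((t : ℂ) ^ j / (j.factorial : ℂ)) t := by
  have h := (((hasDerivAt_id t).ofReal_comp).pow (j + 1)).div_const ((j + 1).factorial : ℂ)
  have h₁ : ((j : ℂ) + 1) ≠ 0 := by exact_mod_cast Nat.succ_ne_zero j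
  have h₂ : (j.factorial : ℂ) ≠ 0 := by exact_mod_cast j.factorial_ne_zero
  refine h.congr_deriv ?_
  rw [Nat.factorial_succ]
  push_cast
  simp only [id]
  field_simp

theorem hasDerivAt_sum_pow_div_factorial (K : ℕ) (c : ℕ → ℂ) (t : ℝ) :
    HasDerivAt (fun s : ℝ => ∑ j ∈ Finset.range (K + 1), (s : ℂ) ^ j / (j.factorial : ℂ) * c j)
      (∑ j ∈ Finset.range K, (t : ℂ) ^ j / (j.factorial : ℂ) * c (j + 1)) t := by
  simp only [Finset.sum_range_succ' _ K]
  simpa using (HasDerivAt.fun_sum fun j (_ : j ∈ Finset.range K) =>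
    (hasDerivAt_pow_div_factorial j t).mul_const (c (j + 1))).add_const (c 0)

/-- `T_t` solves `dT_t/dt = (∑_{a ≥ 1} λ^a L_a) T_t`. -/
theorem hasDerivAt_transportOp (S : RealSmooth (Q n)) (t : ℝ) (r : ℕ) (f : Smooth (P n))
    (x : P n) :
    HasDerivAt (fun s => transportOp S s r f x)
      ((∑ y ∈ Finset.HasAntidiagonal.antidiagonal r,
        PowerSeries.coeff y.1 (correctionSeries S) * transportOp S t y.2) f x) t := by
  have h := hasDerivAt_sum_pow_div_factorial r
    (fun j => PowerSeries.coeff r (correctionSeries S ^ j) f x) t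
  simp only [← transportOp_apply] at h
  refine h.congr_deriv ?_
  have h₁ : (∑ y ∈ Finset.HasAntidiagonal.antidiagonal r,
      PowerSeries.coeff y.1 (correctionSeries S) * transportOp S t y.2) =
      ∑ j ∈ Finset.range (r + 1), ((t : ℂ) ^ j / (j.factorial : ℂ)) •
        PowerSeries.coeff r (correctionSeries S ^ (j + 1)) := by
    simp only [pow_succ', PowerSeries.coeff_mul, Finset.smul_sum]
    rw [Finset.sum_comm]
    refine Finset.sum_congr rfl fun y hy => ?_
    rw [Finset.HasAntidiagonal.mem_antidiagonal] at hy
    rw [transportOp_eq_sum_range S t (show y.2 < r + 1 by omega), Finset.mul_sum]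
    simp only [mul_smul_comm]
  -- Differentiation in `t` shortens the range by one; the surplus term `j = r` contains the
  -- coefficient of `λ^r` in a power of exponent `r + 1`, which is zero.
  rw [h₁, Finset.sum_range_succ, coeff_correctionSeries_pow_eq_zero S (Nat.lt_succ_self r),
    smul_zero, add_zero, LinearMap.sum_apply, sum_apply]
  rfl

theorem contDiff_transportOp_flow (S : RealSmooth (Q n)) (r : ℕ) (f : Smooth (P n)) :
    ContDiff ℝ ∞ fun z : ℝ × P n => transportOp S z.1 r f (flow S z.1 z.2) := by
  simp only [transportOp_apply]
  refine ContDiff.sum fun j _ => ContDiff.mul ?_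
    ((Smooth.contDiff _).comp (contDiff_flow_uncurry S))
  exact ((Complex.ofRealCLM.contDiff.comp contDiff_fst).pow j).div_const _

theorem contDiff_transportOp (S : RealSmooth (Q n)) (r : ℕ) (f : Smooth (P n)) :
    ContDiff ℝ ∞ fun z : ℝ × P n => transportOp S z.1 r f z.2 := by
  simp only [transportOp_apply]
  refine ContDiff.sum fun j _ => ContDiff.mul ?_ ((Smooth.contDiff _).comp contDiff_snd)
  exact ((Complex.ofRealCLM.contDiff.comp contDiff_fst).pow j).div_const _

/-- `d(Φ_t^* T_t)/dt = Φ_t^* L T_t`, where `L` is the Heisenberg operator. -/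
theorem hasDerivAt_transportOp_flow (S : RealSmooth (Q n)) (t : ℝ) (r : ℕ) (f : Smooth (P n))
    (x : P n) :
    HasDerivAt (fun s => transportOp S s r f (flow S s x))
      ((∑ y ∈ Finset.HasAntidiagonal.antidiagonal r,
        heisenbergOp S y.1 * transportOp S t y.2) f (flow S t x)) t := by
  have h := hasDerivAt_comp_graph ((contDiff_transportOp S r f).differentiable (by simp))
    (hasDerivAt_flow_apply S t x) (hasDerivAt_transportOp S t r f (flow S t x))
  refine h.congr_deriv ?_
  -- The derivative of `T_t` gives all `L_a` with `a ≥ 1`; the missing `L_0` is the derivative of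
  -- the moving point.
  have h₁ : (∑ y ∈ Finset.HasAntidiagonal.antidiagonal r,
      heisenbergOp S y.1 * transportOp S t y.2) =
      (∑ y ∈ Finset.HasAntidiagonal.antidiagonal r,
        PowerSeries.coeff y.1 (correctionSeries S) * transportOp S t y.2) +
      heisenbergOp S 0 * transportOp S t r := by
    cases r with
    | zero => simp [correctionSeries]
    | succ r =>
      simp only [Finset.Nat.sum_antidiagonal_succ, correctionSeries, PowerSeries.coeff_mk,
        if_true, zero_mul, zero_add, Nat.succ_ne_zero, if_false]
      rw [add_comm]
  rw [h₁, LinearMap.add_apply, Smooth.add_apply, Module.End.mul_apply, heisenbergOp_zero_apply]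
  rfl

/-! ### Existence and uniqueness of the Heisenberg flow -/

/-- The Heisenberg flow `Φ_t^* T_t`. -/
noncomputable def heisenbergFlow (S : RealSmooth (Q n)) (t : ℝ)
    (f : HahnSeries ℤ (Smooth (P n))) : HahnSeries ℤ (Smooth (P n)) :=
  (formalOp (transportOp S t) f).map (flowStar S t)

theorem coeff_heisenbergFlow_below (S : RealSmooth (Q n)) (t : ℝ)
    {f : HahnSeries ℤ (Smooth (P n))} {N : ℤ} (hf : ∀ m < N, f.coeff m = 0) :
    ∀ m < N, (heisenbergFlow S t f).coeff m = 0 := fun m hm => by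
  rw [heisenbergFlow, HahnSeries.map_coeff, coeff_formalOp_below _ hf m hm, map_zero]

theorem coeff_heisenbergFlow_apply (S : RealSmooth (Q n)) (t : ℝ)
    {f : HahnSeries ℤ (Smooth (P n))} {N : ℤ} (hf : ∀ m < N, f.coeff m = 0) (k : ℕ) (x : P n) :
    (heisenbergFlow S t f).coeff (N + k) x = ∑ y ∈ Finset.HasAntidiagonal.antidiagonal k,
      transportOp S t y.1 (f.coeff (N + y.2)) (flow S t x) := by
  rw [heisenbergFlow, HahnSeries.map_coeff, coeff_formalOp_add _ hf, map_sum, sum_apply]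
  rfl

theorem heisenbergFlow_zero (S : RealSmooth (Q n)) (f : HahnSeries ℤ (Smooth (P n))) :
    heisenbergFlow S 0 f = f := by
  obtain ⟨N, hN⟩ := exists_coeff_eq_zero_below f
  refine hahnSeries_eq_of_below (coeff_heisenbergFlow_below S 0 hN) hN fun k => ?_
  ext x
  rw [coeff_heisenbergFlow_apply S 0 hN, Finset.sum_eq_single (0, k)]
  · rw [transportOp_zero_right, flow_zero]
    rfl
  · rintro ⟨a, b⟩ hab hne
    have ha : a ≠ 0 := by
      rintro rfl
      rw [Finset.HasAntidiagonal.mem_antidiagonal, zero_add] at hab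
      exact hne (Prod.ext rfl hab)
    rw [transportOp_zero_left, if_neg ha]
    rfl
  · simp

theorem isHeisenbergFlow_heisenbergFlow (S : RealSmooth (Q n)) :
    IsHeisenbergFlow S (heisenbergFlow S) := by
  intro f
  obtain ⟨N, hN⟩ := exists_coeff_eq_zero_below f
  refine ⟨heisenbergFlow_zero S f, ?_, ?_, ?_⟩
  · exact fun t₀ => ⟨N, Filter.Eventually.of_forall fun t => coeff_heisenbergFlow_below S t hN⟩
  · intro m
    rcases lt_or_ge m N with hm | hm
    · simp only [coeff_heisenbergFlow_below S _ hN m hm]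
      exact contDiff_const
    · obtain ⟨k, rfl⟩ := Int.le.dest hm
      simp only [coeff_heisenbergFlow_apply S _ hN]
      exact ContDiff.sum fun y _ => contDiff_transportOp_flow S _ _
  · intro t m x
    -- Commutation moves the Heisenberg operator past `Φ_t^*`, where it meets `T_t`.
    have h : formalOp (heisenbergOp S) (heisenbergFlow S t f) = _ :=
      formalOp_map _ (flowStar S t).toLinearMap (heisenbergOp_flowStar S t) _
    rw [heisenberg_rhs, h, formalOp_formalOp, HahnSeries.map_coeff]
    rcases lt_or_ge m N with hm | hm
    · simp only [coeff_heisenbergFlow_below S _ hN m hm, coeff_formalOp_below _ hN m hm, map_zero]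
      exact hasDerivAt_const _ _
    · obtain ⟨k, rfl⟩ := Int.le.dest hm
      simp only [coeff_heisenbergFlow_apply S _ hN]
      rw [coeff_formalOp_add _ hN, map_sum, sum_apply]
      exact HasDerivAt.fun_sum fun y _ => hasDerivAt_transportOp_flow S t y.1 _ x

theorem IsHeisenbergSolution.sub {S : RealSmooth (Q n)}
    {f g : ℝ → HahnSeries ℤ (Smooth (P n))} (hf : IsHeisenbergSolution S f)
    (hg : IsHeisenbergSolution S g) : IsHeisenbergSolution S fun t => f t - g t where
  bddBelow t₀ := by
    obtain ⟨N₁, h₁⟩ := hf.bddBelow t₀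
    obtain ⟨N₂, h₂⟩ := hg.bddBelow t₀
    refine ⟨min N₁ N₂, ?_⟩
    filter_upwards [h₁, h₂] with t h₃ h₄ m hm
    rw [HahnSeries.coeff_sub, h₃ m (by omega), h₄ m (by omega), sub_zero]
  smooth m := (hf.smooth m).sub (hg.smooth m)
  eqn t m x := by
    have h := (hf.eqn t m x).sub (hg.eqn t m x)
    rw [heisenberg_rhs, heisenberg_rhs] at h
    rw [heisenberg_rhs, formalOp_sub]
    exact h

/-- Compactness makes the local bounds on the principal part uniform, so that the induction on the
order has a starting point valid for all times of the interval. -/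
theorem IsHeisenbergSolution.exists_bound {S : RealSmooth (Q n)}
    {f : ℝ → HahnSeries ℤ (Smooth (P n))} (hf : IsHeisenbergSolution S f) (a b : ℝ) :
    ∃ N : ℤ, ∀ t ∈ Set.Icc a b, ∀ m < N, (f t).coeff m = 0 := by
  refine (isCompact_Icc : IsCompact (Set.Icc a b)).induction_on
    (p := fun s => ∃ N : ℤ, ∀ t ∈ s, ∀ m < N, (f t).coeff m = 0) ⟨0, by simp⟩ ?_ ?_ ?_
  · rintro s s' hs ⟨N, hN⟩
    exact ⟨N, fun t ht => hN t (hs ht)⟩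
  · rintro s s' ⟨N, hN⟩ ⟨N', hN'⟩
    refine ⟨min N N', fun t ht m hm => ?_⟩
    rcases ht with ht | ht
    · exact hN t ht m (by omega)
    · exact hN' t ht m (by omega)
  · intro t _
    obtain ⟨N, hN⟩ := hf.bddBelow t
    exact ⟨_, mem_nhdsWithin_of_mem_nhds hN, N, fun t ht => ht⟩

theorem IsHeisenbergSolution.eq_zero {S : RealSmooth (Q n)}
    {f : ℝ → HahnSeries ℤ (Smooth (P n))} (hf : IsHeisenbergSolution S f) (h₀ : f 0 = 0)
    (t : ℝ) : f t = 0 := by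
  obtain ⟨R, hR⟩ := exists_gt |t|
  have hR₀ : (0 : ℝ) ∈ Set.Ioo (-R) R := by
    have := abs_nonneg t
    constructor <;> linarith
  obtain ⟨N, hN⟩ := hf.exists_bound (-R) R
  replace hN : ∀ s ∈ Set.Ioo (-R) R, ∀ m < N, (f s).coeff m = 0 := fun s hs =>
    hN s (Set.Ioo_subset_Icc_self hs)
  suffices h : ∀ k : ℕ, ∀ s ∈ Set.Ioo (-R) R, (f s).coeff (N + k) = 0 from
    hahnSeries_eq_of_below (hN t (abs_lt.1 hR)) (fun _ _ => rfl) fun k => h k t (abs_lt.1 hR)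
  intro k
  induction k using Nat.strong_induction_on with
  | _ k ih =>
    have hd : ∀ (x : P n), ∀ s ∈ Set.Ioo (-R) R,
        HasDerivAt (fun s => (f s).coeff (N + k) (flow S (-s) x)) 0 s := by
      intro x s hs
      have h₁ := hf.eqn s (N + k) (flow S (-s) x)
      -- By induction all lower coefficients vanish on the whole interval, so only `L_0` acts; along
      -- `s ↦ Φ_{-s}(x)` it cancels against the velocity of the curve.
      rw [heisenberg_rhs, coeff_formalOp_add _ (hN s hs), Finset.sum_eq_single (0, k)] at h₁
      · have h₂ : HasDerivAt (fun s => flow S (-s) x) (0, dCov S x.1) s := by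
          refine ((hasDerivAt_flow_apply S (-s) x).scomp s (hasDerivAt_neg s)).congr_deriv ?_
          simp
        refine (hasDerivAt_comp_graph ((hf.smooth (N + k)).differentiable (by simp)) h₂
          h₁).congr_deriv ?_
        rw [heisenbergOp_zero_apply]
        change fderiv ℝ ((f s).coeff (N + k)) (flow S (-s) x) (0, -dCov S x.1) +
          fderiv ℝ ((f s).coeff (N + k)) (flow S (-s) x) (0, dCov S x.1) = 0
        rw [← map_add, Prod.mk_add_mk, neg_add_cancel, add_zero]
        exact map_zero _
      · rintro ⟨a, b⟩ hab hne
        rw [Finset.HasAntidiagonal.mem_antidiagonal] at hab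
        have hb : b < k := by
          rcases Nat.eq_zero_or_pos a with rfl | ha
          · exact absurd (by simpa using hab) hne
          · simp only at hab
            omega
        rw [ih b hb s hs, map_zero]
      · simp
    intro s hs
    ext x
    -- The characteristic through `Φ_s(x)` at time `0` reaches `x` at time `s`, so the value at `(s,
    -- x)` equals an initial value, which is zero.
    have h := isOpen_Ioo.is_const_of_deriv_eq_zero isPreconnected_Ioo
      (fun u hu => (hd (flow S s x) u hu).differentiableAt.differentiableWithinAt)
      (fun u hu => (hd (flow S s x) u hu).deriv) hs hR₀
    simp only [flow_neg_flow, h₀] at h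
    exact h

theorem IsHeisenbergFlow.unique {S : RealSmooth (Q n)}
    {A B : ℝ → HahnSeries ℤ (Smooth (P n)) → HahnSeries ℤ (Smooth (P n))}
    (hA : IsHeisenbergFlow S A) (hB : IsHeisenbergFlow S B) : A = B := by
  funext t f
  rw [← sub_eq_zero]
  exact ((hA f).2.sub (hB f).2).eq_zero (by simp only [(hA f).1, (hB f).1, sub_self]) t

/-! ### The factorization -/

theorem isFactorization_transportOp (S : RealSmooth (Q n)) :
    IsFactorization S (heisenbergFlow S) (transportOp S) where
  zero := transportOp_zero_right S
  diffOp := transportOp_mem_diffOps S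
  factor _ _ := rfl

theorem IsFactorization.coeff_single {S : RealSmooth (Q n)}
    {A : ℝ → HahnSeries ℤ (Smooth (P n)) → HahnSeries ℤ (Smooth (P n))}
    {T : ℝ → ℕ → Module.End ℂ (Smooth (P n))} (hT : IsFactorization S A T) (t : ℝ)
    (f : Smooth (P n)) (r : ℕ) :
    (A t (HahnSeries.single 0 f)).coeff r = flowStar S t (T t r f) := by
  rw [hT.factor, HahnSeries.map_coeff, coeff_formalOp_single]

theorem IsFactorization.unique {S : RealSmooth (Q n)}
    {A : ℝ → HahnSeries ℤ (Smooth (P n)) → HahnSeries ℤ (Smooth (P n))}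
    {T T' : ℝ → ℕ → Module.End ℂ (Smooth (P n))} (hT : IsFactorization S A T)
    (hT' : IsFactorization S A T') : T = T' := by
  funext t r
  refine LinearMap.ext fun f => flowStar_injective S t ?_
  rw [← hT.coeff_single, ← hT'.coeff_single]

theorem IsFactorization.apply_single {S : RealSmooth (Q n)}
    {A : ℝ → HahnSeries ℤ (Smooth (P n)) → HahnSeries ℤ (Smooth (P n))}
    {T : ℝ → ℕ → Module.End ℂ (Smooth (P n))} (hT : IsFactorization S A T) (t : ℝ)
    (f : Smooth (P n)) :
    A t (HahnSeries.single 0 f) = formalSeries fun r => flowStar S t (T t r f) := by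
  refine hahnSeries_eq_of_below (N := 0) (fun m hm => ?_) (coeff_formalSeries_below _) fun k => ?_
  · rw [hT.factor, HahnSeries.map_coeff, coeff_formalOp_below _
      (fun m hm => HahnSeries.coeff_single_of_ne hm.ne) m hm, map_zero]
  · rw [zero_add, hT.coeff_single, coeff_formalSeries]

/-! ### The coefficients of `π₀` -/

/-- The nested sums arise in `π₀`: the outer one from `𝒮`, the middle one from `M_b`, the inner one
from the orders of the two factors. -/
theorem sum_antidiagonalTuple_four {M : Type*} [AddCommMonoid M] (k : ℕ) (g : ℕ → ℕ → ℕ → ℕ → M) :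
    ∑ x ∈ Finset.Nat.antidiagonalTuple 4 k, g (x 0) (x 1) (x 2) (x 3) =
      ∑ x ∈ Finset.HasAntidiagonal.antidiagonal k,
        ∑ y ∈ Finset.HasAntidiagonal.antidiagonal x.2,
          ∑ z ∈ Finset.HasAntidiagonal.antidiagonal y.2, g x.1 y.1 z.1 z.2 := by
  simp only [Finset.sum_sigma']
  refine Finset.sum_nbij'
    (fun x => ⟨(x 0, x 1 + (x 2 + x 3)), (x 1, x 2 + x 3), (x 2, x 3)⟩)
    (fun z => ![z.1.1, z.2.1.1, z.2.2.1, z.2.2.2]) ?_ ?_ ?_ ?_ ?_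
  · intro x hx
    rw [Finset.Nat.mem_antidiagonalTuple, Fin.sum_univ_four] at hx
    simp only [Finset.mem_sigma, Finset.HasAntidiagonal.mem_antidiagonal, and_true]
    omega
  · rintro ⟨⟨a, b⟩, ⟨c, d⟩, e, f⟩ h
    simp only [Finset.mem_sigma, Finset.HasAntidiagonal.mem_antidiagonal] at h
    rw [Finset.Nat.mem_antidiagonalTuple, Fin.sum_univ_four]
    change a + c + e + f = k
    omega
  · intro x _
    funext i
    fin_cases i <;> rfl
  · rintro ⟨⟨a, b⟩, ⟨c, d⟩, e, f⟩ h
    simp only [Finset.mem_sigma, Finset.HasAntidiagonal.mem_antidiagonal] at h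
    obtain ⟨-, h₁, h₂⟩ := h
    subst h₂
    subst h₁
    rfl
  · intro _ _
    rfl

/-- The contribution of `F`, `u` to `π₀` coming from `Δ^a` and `M_b`. -/
noncomputable def piZeroTerm (a b : ℕ) (F : Smooth (P n)) (u : Distr n) : Distr n :=
  ((-Complex.I / 2) ^ a / (a.factorial : ℂ) * ((Complex.I / 2) ^ b / (b.factorial : ℂ))) •
    iStarDistr ((lap ^ a) (weylM dqDistr dpDistr b F (piStarDistr u)))

theorem coeff_piZero (F : ℕ → Smooth (P n)) (φ : ℕ → Distr n) (k : ℕ) :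
    (piZero (formalSeries F) (formalSeries φ)).coeff k =
      ∑ x ∈ Finset.Nat.antidiagonalTuple 4 k, piZeroTerm (x 0) (x 1) (F (x 2)) (φ (x 3)) := by
  have hF := coeff_formalSeries_below F
  have hφ : ∀ m < (0 : ℤ), ((formalSeries φ).map piStarDistr).coeff m = 0 := fun m hm => by
    rw [HahnSeries.map_coeff, coeff_formalSeries_below φ m hm, map_zero]
  have hw : ∀ m < (0 : ℤ),
      (weylStar dqDistr dpDistr (formalSeries F) ((formalSeries φ).map piStarDistr)).coeff m = 0 :=
    fun m hm => coeff_weylStar_below _ _ hF hφ m (by omega)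
  have hk := coeff_formalOp_add
    (fun a => ((-Complex.I / 2) ^ a / (a.factorial : ℂ)) • (lap : Module.End ℂ (FibreDistr n)) ^ a)
    hw k
  have hm := coeff_weylStar_add dqDistr dpDistr hF hφ
  simp only [zero_add, HahnSeries.map_coeff, coeff_formalSeries] at hk hm
  rw [sum_antidiagonalTuple_four k fun a b c d => piZeroTerm a b (F c) (φ d), piZero,
    HahnSeries.map_coeff, calS, hk]
  simp only [hm, map_sum, LinearMap.smul_apply, map_smul, smul_smul, piZeroTerm]
  simp only [mul_comm]

theorem coeff_piZero_below (F : ℕ → Smooth (P n)) (φ : ℕ → Distr n) :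
    ∀ m < (0 : ℤ), (piZero (formalSeries F) (formalSeries φ)).coeff m = 0 := fun m hm => by
  have hφ : ∀ m < (0 : ℤ), ((formalSeries φ).map piStarDistr).coeff m = 0 := fun m hm => by
    rw [HahnSeries.map_coeff, coeff_formalSeries_below φ m hm, map_zero]
  rw [piZero, HahnSeries.map_coeff, calS, coeff_formalOp_below (N := 0) _ (fun m hm =>
    coeff_weylStar_below _ _ (coeff_formalSeries_below F) hφ m (by omega)) m hm, map_zero]

theorem piZeroTerm_zero_zero (F : Smooth (P n)) (u : Distr n) :
    piZeroTerm 0 0 F u = iStar F • u := by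
  have h : iStarDistr (F • piStarDistr u) = iStar F • u := by
    change iStarDistr (FibreDistr.tmul (F * 1) u) = _
    rw [mul_one]
    rfl
  simp [piZeroTerm, weylM, h]

theorem piZeroTerm_one_zero (F : Smooth (P n)) (u : Distr n) :
    piZeroTerm 1 0 F u = -((Complex.I / 2) • iStarDistr (lap (F • piStarDistr u))) := by
  rw [← neg_smul]
  simp [piZeroTerm, weylM, neg_div]

theorem piZeroTerm_zero_one (F : Smooth (P n)) (u : Distr n) :
    piZeroTerm 0 1 F u = (Complex.I / 2) • iStarDistr (poisson F (piStarDistr u)) := by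
  simp [piZeroTerm, weylM, poisson]

/-- If `d ≥ r`, the other three entries have sum at most one. These are the terms not on the right
side of the recursion. -/
theorem filter_antidiagonalTuple_four (r : ℕ) :
    (Finset.Nat.antidiagonalTuple 4 (r + 1)).filter (fun x => ¬ x 3 < r) =
      {![0, 0, 0, r + 1], ![0, 0, 1, r], ![1, 0, 0, r], ![0, 1, 0, r]} := by
  ext x
  have hx : ∀ a b c d, x = ![a, b, c, d] ↔ x 0 = a ∧ x 1 = b ∧ x 2 = c ∧ x 3 = d :=
    fun a b c d => by
      rw [funext_iff, Fin.forall_fin_succ, Fin.forall_fin_succ, Fin.forall_fin_succ,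
        Fin.forall_fin_succ]
      simp
  simp only [Finset.mem_filter, Finset.Nat.mem_antidiagonalTuple, Fin.sum_univ_four,
    Finset.mem_insert, Finset.mem_singleton, hx]
  omega

theorem coeff_piZero_succ (F : ℕ → Smooth (P n)) (φ : ℕ → Distr n) (r : ℕ) :
    (piZero (formalSeries F) (formalSeries φ)).coeff ((r + 1 : ℕ) : ℤ) =
      (∑ x ∈ (Finset.Nat.antidiagonalTuple 4 (r + 1)).filter (fun x => x 3 < r),
        piZeroTerm (x 0) (x 1) (F (x 2)) (φ (x 3))) +
      (iStar (F 0) • φ (r + 1) + (iStar (F 1) • φ r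
        - (Complex.I / 2) • iStarDistr (lap (F 0 • piStarDistr (φ r)))
        + (Complex.I / 2) • iStarDistr (poisson (F 0) (piStarDistr (φ r))))) := by
  rw [coeff_piZero, ← Finset.sum_filter_add_sum_filter_not _ (fun x => x 3 < r),
    filter_antidiagonalTuple_four, Finset.sum_insert (by simp), Finset.sum_insert (by simp),
    Finset.sum_insert (by simp), Finset.sum_singleton]
  congr 1
  rw [sub_eq_add_neg, ← piZeroTerm_one_zero, ← piZeroTerm_zero_one, ← piZeroTerm_zero_zero,
    ← piZeroTerm_zero_zero, add_assoc (piZeroTerm 0 0 (F 1) (φ r))]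
  rfl

/-! ### The Hamilton–Jacobi equation and the Schrödinger equation order by order. -/

theorem iStar_flowStar_hamiltonian {H : RealSmooth (P n)} {S : RealSmooth (Q n)} {E : ℝ}
    (hHJ : ∀ q : Q n, H.1 (q, dCov S q) = E) :
    iStar (flowStar S (-1) (complexify H)) = algebraMap ℂ (Smooth (Q n)) E := by
  ext q
  -- The time `-1` is chosen so that the flow carries the zero section onto the graph of `dS`, where
  -- `H = E`.
  have h : flow S (-1) (q, 0) = (q, dCov S q) := by simp [flow]
  change ((H.1 (flow S (-1) (q, 0)) : ℝ) : ℂ) = (E : ℂ)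
  rw [h, hHJ]

theorem piZero_eq_smul_iff (F : ℕ → Smooth (P n)) (φ : ℕ → Distr n) (c : ℂ)
    (h₀ : iStar (F 0) = algebraMap ℂ (Smooth (Q n)) c) :
    piZero (formalSeries F) (formalSeries φ) = c • formalSeries φ ↔
      ∀ r : ℕ, iStar (F 1) • φ r
        - (Complex.I / 2) • iStarDistr (lap (F 0 • piStarDistr (φ r)))
        + (Complex.I / 2) • iStarDistr (poisson (F 0) (piStarDistr (φ r))) =
      -∑ x ∈ (Finset.Nat.antidiagonalTuple 4 (r + 1)).filter (fun x => x 3 < r),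
        piZeroTerm (x 0) (x 1) (F (x 2)) (φ (x 3)) := by
  have hs : ∀ k : ℕ, iStar (F 0) • φ k = (c • formalSeries φ).coeff k := fun k => by
    rw [h₀, algebraMap_smul, HahnSeries.coeff_smul, coeff_formalSeries]
  have hr : ∀ r : ℕ, ((piZero (formalSeries F) (formalSeries φ)).coeff ((r + 1 : ℕ) : ℤ) =
      (c • formalSeries φ).coeff ((r + 1 : ℕ) : ℤ)) ↔ iStar (F 1) • φ r
        - (Complex.I / 2) • iStarDistr (lap (F 0 • piStarDistr (φ r)))
        + (Complex.I / 2) • iStarDistr (poisson (F 0) (piStarDistr (φ r))) =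
      -∑ x ∈ (Finset.Nat.antidiagonalTuple 4 (r + 1)).filter (fun x => x 3 < r),
        piZeroTerm (x 0) (x 1) (F (x 2)) (φ (x 3)) := fun r => by
    -- The term `i^*F_0 φ_{r+1} = c φ_{r+1}` cancels, so order `r + 1` of the equation becomes the
    -- recursion with index `r`.
    rw [coeff_piZero_succ, ← hs, add_left_comm, add_eq_left, eq_neg_iff_add_eq_zero, add_comm]
  refine ⟨fun h r => (hr r).1 (by rw [h]), fun h => ?_⟩
  refine hahnSeries_eq_of_below (coeff_piZero_below F φ) (fun m hm => ?_) fun k => ?_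
  · rw [HahnSeries.coeff_smul, coeff_formalSeries_below φ m hm, smul_zero]
  · rw [zero_add]
    cases k with
    | zero =>
      -- Order zero reads `i^*F_0 φ_0 = c φ_0` and imposes no condition.
      rw [coeff_piZero, Finset.Nat.antidiagonalTuple_zero_right, Finset.sum_singleton, ← hs]
      exact piZeroTerm_zero_zero _ _
    | succ r => exact (hr r).2 (h r)

end FormalWKB

theorem mainTheorem1 (n : ℕ) (H : RealSmooth (P n)) (S : RealSmooth (Q n)) (E : ℝ)
    (hHJ : ∀ q : Q n, H.1 (q, dCov S q) = E) :
    (∃! A : ℝ → HahnSeries ℤ (Smooth (P n)) → HahnSeries ℤ (Smooth (P n)),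
      IsHeisenbergFlow S A) ∧
    ∀ A : ℝ → HahnSeries ℤ (Smooth (P n)) → HahnSeries ℤ (Smooth (P n)),
      IsHeisenbergFlow S A →
      (∃! T : ℝ → ℕ → Module.End ℂ (Smooth (P n)), IsFactorization S A T) ∧
      ∀ T : ℝ → ℕ → Module.End ℂ (Smooth (P n)), IsFactorization S A T →
        ∀ φ : ℕ → Distr n,
          piZero (A (-1) (HahnSeries.single 0 (complexify H))) (formalSeries φ) =
              (E : ℂ) • formalSeries φ ↔
          ∀ r : ℕ,
            iStar (flowStar S (-1) (T (-1) 1 (complexify H))) • φ r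
              - (Complex.I / 2) • iStarDistr
                  (lap (flowStar S (-1) (complexify H) • piStarDistr (φ r)))
              + (Complex.I / 2) • iStarDistr
                  (poisson (flowStar S (-1) (complexify H)) (piStarDistr (φ r)))
            = - ∑ x ∈ (Finset.Nat.antidiagonalTuple 4 (r + 1)).filter (fun x => x 3 < r),
                ((-Complex.I / 2) ^ x 0 / ((x 0).factorial : ℂ) *
                  ((Complex.I / 2) ^ x 1 / ((x 1).factorial : ℂ))) •
                iStarDistr ((lap ^ x 0) (weylM dqDistr dpDistr (x 1)
                  (flowStar S (-1) (T (-1) (x 2) (complexify H))) (piStarDistr (φ (x 3))))) := by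
  refine ⟨⟨heisenbergFlow S, isHeisenbergFlow_heisenbergFlow S, fun A hA =>
    hA.unique (isHeisenbergFlow_heisenbergFlow S)⟩, fun A hA => ?_⟩
  obtain rfl := hA.unique (isHeisenbergFlow_heisenbergFlow S)
  refine ⟨⟨transportOp S, isFactorization_transportOp S, fun T hT =>
    hT.unique (isFactorization_transportOp S)⟩, fun T hT φ => ?_⟩
  have h₀ : flowStar S (-1) (T (-1) 0 (complexify H)) = flowStar S (-1) (complexify H) := by
    rw [hT.zero]
    rfl
  rw [hT.apply_single, piZero_eq_smul_iff _ _ (E : ℂ)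
    (by rw [h₀, iStar_flowStar_hamiltonian hHJ])]
  simp only [h₀, piZeroTerm]
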